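/- Let $\mu>0$, let $\alpha\neq\beta$ be real, and put $d=\frac1{\beta-\alpha}$, $a=\frac{(1+\alpha^2)^2}{4(\beta-\alpha)}$, $c=-\frac{3(1+\alpha\beta)(1+\alpha^2)}{2(\beta-\alpha)^2}$; let $\lambda$ be either of the two (real, nonzero) roots of $\lambda^2+c\lambda-2ad=0$. For $\omega\in\mathbb R$ put $b=\frac{1+\alpha^2}{2}\Big(\frac{2(\alpha\omega+\mu)}{\beta-\alpha}-\frac{3(1+\alpha\beta)(\omega-\mu\alpha)}{(\beta-\alpha)^2}\Big)$, $e=\frac{\omega-\mu\alpha}{\beta-\alpha}$, $\tilde e=\lambda b/a$. Consider the 4-D system $$\dot{\tilde M}=\tilde N P,\qquad \dot{\tilde N}=\tfrac{\lambda}{a}\tilde M+kP,\qquad \dot P=Q,\qquad \dot Q=\tfrac1\lambda(\tilde M-dP^2-\tilde eP),$$ with $e=\tilde e+\frac a\lambda k$, and the consistency condition $(1+\alpha^2)M=(\frac a\lambda\tilde N-\lambda Q)^2$, where $$M=\tfrac{d(1+\alpha^2)}{2\lambda}(dP+e)(\tilde M-dP^2-\tilde eP)-\tfrac{d^2(1+\alpha^2)}4Q^2+(\alpha\omega+\mu)(dP+e)^2-(1+\alpha\beta)(dP+e)^3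 .$$ Let $a_2\neq0$ and $\sigma\in\{1,-1\}$. Then there are $\varepsilon_0>0$, $C\in\mathbb R$, continuous functions $\omega,k_1,k_2,\gamma,\Omega,q$ of $\varepsilon\in(-\varepsilon_0,\varepsilon_0)$ and $X=(x,y,z,w)(\varepsilon,\tau)$, jointly continuous in $\varepsilon\in(-\varepsilon_0,\varepsilon_0)$, $\tau\in\mathbb R$, such that at $\varepsilon=0$ $$\omega=\mu\alpha,\quad k_2=-\tfrac{3\lambda}{a}da_2,\quad \gamma=\tfrac ca a_2,\quad \Omega=2\sqrt\mu,\quad q=\sqrt\mu,$$ $$X(0,\tau)=\big(4\mu\lambda a_2,\ -\tfrac{\lambda^2}{a}\Omega a_4\sin\Omega\tau,\ a_2+a_4\cos\Omega\tau,\ -\Omega a_4\sin\Omega\tau\big)\quad\text{with } a_4=2\sigma a_2,\ \Omega=2\sqrt\mu,$$ and such that for every $\varepsilon\in(-\varepsilon_0,\varepsilon_0)$, with all constants taken at $\omega=\omega(\varepsilon)$: 1. $\tilde e/\lambda>0$; $k_1=-\lambda\tilde e/a$; the matrix of the linear part of the 4-D system at the origin with $k=k_1$ has a two-dimensional kernel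 (its eigenvalue $0$ has two independent eigenvectors); $e=\tilde e+\frac a\lambda(k_1+\varepsilon k_2)$; $\Omega>0$ and $\Omega^2=\tilde e/\lambda+\varepsilon\gamma$; $q>0$, $\omega=\mu\beta+(\alpha-\beta)q^2$ and $e=\mu-q^2$, i.e. $\pm q$ are the wavenumbers of the plane waves of frequency $\omega$, and they tend to $\pm\sqrt\mu$ as $\varepsilon\to0$. 2. $X(\varepsilon,\cdot)$ solves the 4-D system with $k=k_1+\varepsilon k_2$ rescaled by $(\tilde M,\tilde N,P,Q)=\varepsilon(x,y,z,w)$, and $(\tilde M,\tilde N,P,Q)=\varepsilon X(\varepsilon,\cdot)$ solves the 4-D system itself and satisfies the consistency condition at every $\tau$. It is symmetric ($x,z$ even, $y,w$ odd in $\tau$), periodic of period $2\pi/\Omega$, bounded by $\|X(\varepsilon,\tau)\|_\infty\le C$ for all $\tau$, and $z(\varepsilon,\cdot)$ is not constant. 3. If $\varepsilon d a_2<0$, there are $C^2$ functions $R,\varphi:\mathbb R\to\mathbb R$ such that, with $G=\varphi_xR^2$, $$(1+\alpha^2)G_x=(\beta-\alpha)R^4-(\omega-\mu\alpha)R^2,\qquad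 (1+\alpha^2)G^2=(1+\alpha^2)R^3R_{xx}+(\alpha\omega+\mu)R^4-(1+\alpha\beta)R^6,$$ $R^2=e+dP$, $G=(\frac a\lambda\tilde N-\lambda Q)/(1+\alpha^2)$, $R(-x)=-\sigma R(x)$, $\varphi(-x)=\varphi(x)$, $R(x+\frac{2\pi}\Omega)=-R(x)$, $\varphi(x+\frac{2\pi}\Omega)=\varphi(x)$, $R^2\le C|\varepsilon|$; and $A(x,t)=R(x)e^{i\varphi(x)-i\omega t}$ is a classical solution of $A_t=\mu A+(1+i\alpha)A_{xx}-(1+i\beta)|A|^2A$. These are stationary modulated-amplitude waves bifurcating from $A=0$. -/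

import Mathlib

noncomputable section

namespace CGL

/-! Constants of the reduction of the stationary equation. -/

/-- `d = 1 / (β - α)`. -/
def dC (α β : ℝ) : ℝ := 1 / (β - α)

/-- `a = (1 + α²)² / (4 (β - α))`. -/
def aC (α β : ℝ) : ℝ := (1 + α ^ 2) ^ 2 / (4 * (β - α))

def bC (μ α β ω : ℝ) : ℝ :=
  (1 + α ^ 2) / 2 *
    (2 * (α * ω + μ) / (β - α) - 3 * (1 + α * β) * (ω - μ * α) / (β - α) ^ 2)

def cC (α β : ℝ) : ℝ := -(3 * (1 + α * β) * (1 + α ^ 2) / (2 * (β - α) ^ 2))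

/-- `e = (ω - μ α) / (β - α)`, the squared amplitude of the plane wave of frequency `ω`. -/
def eC (μ α β ω : ℝ) : ℝ := (ω - μ * α) / (β - α)

/-- `ẽ`, determined by `a / lam = b / ẽ`. -/
def eTilde (μ α β lam ω : ℝ) : ℝ := lam * bC μ α β ω / aC α β

/-- The admissible values of `lam` are the two roots of `lam² + c lam - 2 a d = 0`. -/
def IsLambda (α β lam : ℝ) : Prop :=
  lam ^ 2 + cC α β * lam - 2 * aC α β * dC α β = 0

/-! The 4-D system for `(M̃, Ñ, P, Q)`, in this order. -/

/-- The vector field of the 4-D system. -/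
def field4 (μ α β lam ω k : ℝ) (X : Fin 4 → ℝ) : Fin 4 → ℝ :=
  ![X 1 * X 2,
    lam / aC α β * X 0 + k * X 2,
    X 3,
    1 / lam * (X 0 - dC α β * X 2 ^ 2 - eTilde μ α β lam ω * X 2)]

/-- The matrix of the linear part at the origin, for `k = k₁` at lowest order. -/
def linMatrix (μ α β lam ω k₁ : ℝ) : Matrix (Fin 4) (Fin 4) ℝ :=
  !![0, 0, 0, 0;
     lam / aC α β, 0, k₁, 0;
     0, 0, 0, 1;
     1 / lam, 0, -eTilde μ α β lam ω / lam, 0]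

/-- The quadratic part of the system rescaled by `ε`, for `k = k₁ + ε k₂`. -/
def quadPart (α β lam k₂ : ℝ) (X : Fin 4 → ℝ) : Fin 4 → ℝ :=
  ![X 1 * X 2, k₂ * X 2, 0, -(dC α β / lam) * X 2 ^ 2]

/-- The quantity `M` expressed in the variables `(M̃, Ñ, P, Q)`. -/
def bigM (μ α β lam ω : ℝ) (X : Fin 4 → ℝ) : ℝ :=
  dC α β * (1 + α ^ 2) / (2 * lam) * (dC α β * X 2 + eC μ α β ω)
      * (X 0 - dC α β * X 2 ^ 2 - eTilde μ α β lam ω * X 2)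
    - dC α β ^ 2 * (1 + α ^ 2) / 4 * X 3 ^ 2
    + (α * ω + μ) * (dC α β * X 2 + eC μ α β ω) ^ 2
    - (1 + α * β) * (dC α β * X 2 + eC μ α β ω) ^ 3

/-- The consistency condition at a point of the phase space. -/
def Consistent (μ α β lam ω : ℝ) (X : Fin 4 → ℝ) : Prop :=
  (1 + α ^ 2) * bigM μ α β lam ω X = (aC α β / lam * X 1 - lam * X 3) ^ 2

/-- Reversibility of an orbit: `M̃`, `P` are even and `Ñ`, `Q` are odd. -/
def IsSymmetricOrbit (X : ℝ → Fin 4 → ℝ) : Prop :=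
  ∀ τ, X (-τ) = ![X τ 0, -X τ 1, X τ 2, -X τ 3]

/-- The lowest-order orbit, of angular frequency `2 √μ`. The sign `σ = ± 1` is that of the
coefficient `a₄ = ± 2 a₂` of the oscillating part. -/
def zeroOrder (μ α β lam a₂ σ τ : ℝ) : Fin 4 → ℝ :=
  ![4 * μ * lam * a₂,
    -(lam ^ 2 / aC α β * (2 * √μ) * (2 * σ * a₂) * Real.sin (2 * √μ * τ)),
    a₂ + 2 * σ * a₂ * Real.cos (2 * √μ * τ),
    -(2 * √μ * (2 * σ * a₂) * Real.sin (2 * √μ * τ))]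

/-! The Ginzburg-Landau equation and its stationary form. -/

/-- `A` is a classical solution of
`A_t = μ A + (1 + i α) A_xx - (1 + i β) |A|² A` on the whole line, for all times. -/
def SolvesCGL (μ α β : ℝ) (A : ℝ → ℝ → ℂ) : Prop :=
  (∀ t, ContDiff ℝ 2 (fun x => A x t)) ∧ (∀ x, ContDiff ℝ 1 (fun t => A x t)) ∧
  ∀ x t, deriv (fun s => A x s) t =
    μ * A x t + (1 + Complex.I * α) * iteratedDeriv 2 (fun y => A y t) x
      - (1 + Complex.I * β) * (‖A x t‖ : ℂ) ^ 2 * A x t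

/-- The "angular momentum" `G = φ_x R²`. -/
def angMom (R φ : ℝ → ℝ) (x : ℝ) : ℝ := deriv φ x * R x ^ 2

/-- The two real equations satisfied by the profile `R` and the phase `φ` of a stationary
solution `R(x) exp (i φ(x) - i ω t)`. -/
def SolvesStationary (μ α β ω : ℝ) (R φ : ℝ → ℝ) : Prop :=
  ContDiff ℝ 2 R ∧ ContDiff ℝ 2 φ ∧
  (∀ x, (1 + α ^ 2) * deriv (angMom R φ) x =
    (β - α) * R x ^ 4 - (ω - μ * α) * R x ^ 2) ∧
  (∀ x, (1 + α ^ 2) * angMom R φ x ^ 2 =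
    (1 + α ^ 2) * R x ^ 3 * iteratedDeriv 2 R x + (α * ω + μ) * R x ^ 4
      - (1 + α * β) * R x ^ 6)

end CGL

end

noncomputable section

namespace CGL

open BoundedContinuousFunction ComplexConjugate

/-! The 4-D system is a rewriting of a complex second-order equation. Substituting `√δ B(x)
e^{-iωt}` into the Ginzburg-Landau equation gives `B'' = -p B + δ ν |B|² B` with `(1 + iα) p = μ +
iω` and `(1 + iα) ν = 1 + iβ`. With `n = |B|²`, `j = Re (B̄ B')`, `K = |B'|²`, `m = Im (B̄ B')`, the
variables `P`, `Q`, `M̃`, `Ñ` are polynomials in `n, j, K, m` (`orbitPoint`). The 4-D equations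
follow by differentiation, the first of them using the quadratic equation for `lam`
(`hasDerivAt_orbitPoint`). The consistency condition is the identity `n K = j² + m²`
(`consistent_smul_orbitPoint`). None of this needs `δ > 0`, which is why the 4-D orbits exist for
both signs of `ε`; a real amplitude `R = √δ S` needs `δ > 0`.

It remains to find periodic solutions bifurcating from `B = 0`. In the phase `θ = Ω x / 2` the
equation is `u'' + u = t ν (|u|² u - r u)`, where `t` is a small real parameter and `r` a complex
one. This is solved by Lyapunov-Schmidt reduction among even `π`-antiperiodic functions `u = cos +
v` with `v` orthogonal to `cos`: `r` is chosen to remove the resonance, and `v` is a fixed point of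
a small contraction (`exists_continuous_fixedPoint`, `exists_even_profile`). The complex number `r`
carries two real conditions, which determine the two real unknowns `Ω` and `ω` explicitly
(`frequency_identity`). No further implicit function argument is needed.

The phase of a solution with zeros is regular because symmetry pins the zeros of `u` to those of
`cos`. The quotient `u / cos` is then `C²` and within distance `1` of `1`, so it has a `C²` modulus
and argument (`exists_polar`). The amplitude keeps the sign of `cos` and changes sign over half a
period of `u`. The two values of `σ` are the same family seen from a crest or from a zero, that is,
shifted by `π / 2`. -/

/-! ### A contraction principle with a parameter. -/

/-- A small multiple of a map that is bounded and Lipschitz on the unit ball has a fixed point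
depending continuously on the multiple. -/
theorem exists_continuous_fixedPoint {E : Type*} [NormedAddCommGroup E] [NormedSpace ℝ E]
    [CompleteSpace E] (F : E → E) {M L : ℝ} (hM0 : 0 ≤ M) (hL0 : 0 ≤ L)
    (hM : ∀ v, ‖v‖ ≤ 1 → ‖F v‖ ≤ M)
    (hL : ∀ v w, ‖v‖ ≤ 1 → ‖w‖ ≤ 1 → ‖F v - F w‖ ≤ L * ‖v - w‖) :
    ∃ t₀ > (0 : ℝ), ∃ v : ℝ → E, Continuous v ∧
      ∀ t, |t| ≤ t₀ → ‖v t‖ ≤ 1 ∧ v t = t • F (v t) := by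
  -- This size gives both `t₀ M ≤ 1`, so the unit ball is preserved, and `t₀ L ≤ 1 / 2`, a
  -- contraction ratio of one half.
  set t₀ : ℝ := 1 / (2 * (M + L + 1)) with ht₀
  have hpos : 0 < t₀ := by positivity
  have hML : t₀ * (2 * (M + L + 1)) = 1 := by rw [ht₀]; field_simp
  have htM : t₀ * M ≤ 1 := by nlinarith
  have htL : t₀ * L ≤ 1 / 2 := by nlinarith
  have key : ∀ s : ℝ, |s| ≤ t₀ → ∃ v : E, ‖v‖ ≤ 1 ∧ v = s • F v := by
    intro s hs
    have hmaps : Set.MapsTo (fun v => s • F v) (Metric.closedBall (0 : E) 1)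
        (Metric.closedBall (0 : E) 1) := by
      intro v hv
      rw [mem_closedBall_zero_iff] at hv ⊢
      rw [norm_smul, Real.norm_eq_abs]
      calc |s| * ‖F v‖ ≤ t₀ * M := by
            gcongr
            exact hM v hv
        _ ≤ 1 := htM
    have hcon : ContractingWith (1 / 2 : NNReal) (hmaps.restrict _ _ _) := by
      refine ⟨by rw [← NNReal.coe_lt_coe]; norm_num, LipschitzWith.of_dist_le_mul ?_⟩
      rintro ⟨v, hv⟩ ⟨w, hw⟩
      rw [mem_closedBall_zero_iff] at hv hw
      change dist (s • F v) (s • F w) ≤ _ * dist v w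
      rw [dist_eq_norm, dist_eq_norm]
      rw [← smul_sub, norm_smul, Real.norm_eq_abs]
      calc |s| * ‖F v - F w‖ ≤ t₀ * (L * ‖v - w‖) := by
            gcongr
            exact hL v w hv hw
        _ = t₀ * L * ‖v - w‖ := by ring
        _ ≤ 1 / 2 * ‖v - w‖ := by gcongr
        _ = _ := by simp
    obtain ⟨v, hv, hfix, -⟩ := ContractingWith.exists_fixedPoint'
      Metric.isClosed_closedBall.isComplete hmaps hcon (x := 0) (by simp) (edist_ne_top _ _)
    exact ⟨v, mem_closedBall_zero_iff.1 hv, hfix.symm⟩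
  -- Clamping the parameter makes the fixed point defined and continuous on the whole line, so no
  -- domain has to be carried along.
  let c : ℝ → ℝ := fun t => max (-t₀) (min t t₀)
  have hc : Continuous c := by fun_prop
  have hcb : ∀ t, |c t| ≤ t₀ := fun t =>
    abs_le.2 ⟨le_max_left _ _, max_le (by linarith) (min_le_right _ _)⟩
  choose v hv1 hv2 using fun t => key (c t) (hcb t)
  refine ⟨t₀, hpos, v, ?_, ?_⟩
  · have hlip : ∀ t t', dist (v t) (v t') ≤ 2 * M * dist (c t) (c t') := by
      intro t t'
      -- The first term is absorbed by the contraction, leaving a Lipschitz bound with constant `2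
      -- M` in the clamped parameter.
      have h1 : v t - v t' = c t • (F (v t) - F (v t')) + (c t - c t') • F (v t') := by
        conv_lhs => rw [hv2 t, hv2 t']
        rw [smul_sub, sub_smul]; abel
      have h2 : ‖v t - v t'‖ ≤ 1 / 2 * ‖v t - v t'‖ + |c t - c t'| * M := by
        calc ‖v t - v t'‖ ≤ ‖c t • (F (v t) - F (v t'))‖ + ‖(c t - c t') • F (v t')‖ := by
              conv_lhs => rw [h1]
              exact norm_add_le _ _
          _ ≤ t₀ * (L * ‖v t - v t'‖) + |c t - c t'| * M := by
              rw [norm_smul, norm_smul, Real.norm_eq_abs, Real.norm_eq_abs]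
              gcongr
              · exact hcb t
              · exact hL _ _ (hv1 t) (hv1 t')
              · exact hM _ (hv1 t')
          _ ≤ _ := by nlinarith [norm_nonneg (v t - v t')]
      rw [dist_eq_norm, Real.dist_eq]
      linarith
    rw [continuous_iff_continuousAt]
    intro t'
    rw [ContinuousAt, tendsto_iff_dist_tendsto_zero]
    refine squeeze_zero (fun _ => dist_nonneg) (fun t => hlip t t') ?_
    have := (tendsto_iff_dist_tendsto_zero.1 (hc.tendsto t')).const_mul (2 * M)
    simpa using this
  · intro t ht
    have : c t = t := by
      have := abs_le.1 ht
      simp only [c]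
      rw [min_eq_left this.2, max_eq_right this.1]
    exact ⟨hv1 t, by conv_lhs => rw [hv2 t, this]⟩

/-! ### Periodic primitives and the cosine moment. -/

/-- The primitive vanishing at the origin. -/
def prim (g : ℝ → ℂ) (θ : ℝ) : ℂ := ∫ s in (0 : ℝ)..θ, g s

theorem prim_periodic {g : ℝ → ℂ} (hg : Continuous g) {T : ℝ}
    (hper : Function.Periodic g T) (h0 : ∫ s in (0 : ℝ)..T, g s = 0) :
    Function.Periodic (prim g) T := by
  intro θ
  have h := hper.intervalIntegral_add_eq θ 0
  rw [zero_add, h0] at h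
  simp only [prim]
  rw [← intervalIntegral.integral_add_adjacent_intervals (b := θ)
    (hg.intervalIntegrable _ _) (hg.intervalIntegrable _ _), h, add_zero]

theorem hasDerivAt_prim {g : ℝ → ℂ} (hg : Continuous g) (θ : ℝ) :
    HasDerivAt (prim g) (g θ) θ :=
  intervalIntegral.integral_hasDerivAt_right (hg.intervalIntegrable _ _)
    (hg.stronglyMeasurableAtFilter _ _) hg.continuousAt

theorem prim_neg (g : ℝ → ℂ) (θ : ℝ) : prim g (-θ) = -prim (fun s => g (-s)) θ := by
  simp only [prim]
  rw [intervalIntegral.integral_comp_neg, neg_zero, intervalIntegral.integral_symm]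

/-- A vanishing mean makes the primitive periodic, so one period controls it on the whole line. -/
theorem norm_prim_le {g : ℝ → ℂ} (hg : Continuous g) {T C : ℝ} (hT : 0 < T)
    (hper : Function.Periodic g T) (h0 : ∫ s in (0 : ℝ)..T, g s = 0)
    (hC0 : 0 ≤ C) (hC : ∀ s, ‖g s‖ ≤ C) (θ : ℝ) : ‖prim g θ‖ ≤ T * C := by
  obtain ⟨y, hy, hy'⟩ := (prim_periodic hg hper h0).exists_mem_Ico₀ hT θ
  rw [hy']
  calc ‖prim g y‖ ≤ C * |y - 0| :=
        intervalIntegral.norm_integral_le_of_norm_le_const fun s _ => hC s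
    _ ≤ T * C := by
        rw [sub_zero, abs_of_nonneg hy.1, mul_comm]
        gcongr
        exact hy.2.le

/-- The first cosine moment over half a period. -/
def cosMoment (f : ℝ → ℂ) : ℂ := ∫ s in (0 : ℝ)..Real.pi, (Real.cos s : ℂ) * f s

theorem continuous_cosC : Continuous fun s : ℝ => (Real.cos s : ℂ) := by fun_prop
theorem continuous_sinC : Continuous fun s : ℝ => (Real.sin s : ℂ) := by fun_prop

theorem continuous_cosC_mul {f : ℝ → ℂ} (hf : Continuous f) :
    Continuous fun s : ℝ => (Real.cos s : ℂ) * f s := continuous_cosC.mul hf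

theorem continuous_sinC_mul {f : ℝ → ℂ} (hf : Continuous f) :
    Continuous fun s : ℝ => (Real.sin s : ℂ) * f s := continuous_sinC.mul hf

theorem norm_cosC_le (s : ℝ) : ‖(Real.cos s : ℂ)‖ ≤ 1 := by
  rw [Complex.norm_real]; exact Real.abs_cos_le_one s
theorem norm_sinC_le (s : ℝ) : ‖(Real.sin s : ℂ)‖ ≤ 1 := by
  rw [Complex.norm_real]; exact Real.abs_sin_le_one s

theorem norm_cosMoment_le {f : ℝ → ℂ} {C : ℝ} (hC : ∀ s, ‖f s‖ ≤ C) :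
    ‖cosMoment f‖ ≤ Real.pi * C := by
  have : ‖cosMoment f‖ ≤ C * |Real.pi - 0| := by
    refine intervalIntegral.norm_integral_le_of_norm_le_const fun s _ => ?_
    rw [norm_mul]
    calc _ ≤ 1 * ‖f s‖ := by gcongr; exact norm_cosC_le s
      _ ≤ C := by rw [one_mul]; exact hC s
  rwa [sub_zero, abs_of_pos Real.pi_pos, mul_comm] at this

theorem cosMoment_sub_mul {f g : ℝ → ℂ} (hf : Continuous f) (hg : Continuous g) (c : ℂ) :
    cosMoment (fun s => f s - c * g s) = cosMoment f - c * cosMoment g := by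
  simp only [cosMoment]
  rw [← intervalIntegral.integral_const_mul, ← intervalIntegral.integral_sub]
  · congr 1; ext s; ring
  · exact (continuous_cosC_mul hf).intervalIntegrable _ _
  · exact (continuous_const.mul (continuous_cosC_mul hg)).intervalIntegrable _ _

theorem cosMoment_cos : cosMoment (fun s => (Real.cos s : ℂ)) = (Real.pi / 2 : ℝ) := by
  have h : (fun s : ℝ => (Real.cos s : ℂ) * (Real.cos s : ℂ)) =
      fun s : ℝ => ((Real.cos s ^ 2 : ℝ) : ℂ) := by
    ext s; push_cast; ring
  simp only [cosMoment, h]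
  rw [intervalIntegral.integral_ofReal, integral_cos_sq]
  simp

theorem cosMoment_cos_cube : cosMoment (fun s => (Real.cos s : ℂ) ^ 3) =
    (3 * Real.pi / 8 : ℝ) := by
  have h : (fun s : ℝ => (Real.cos s : ℂ) * (Real.cos s : ℂ) ^ 3) =
      fun s : ℝ => ((Real.cos s ^ 4 : ℝ) : ℂ) := by
    ext s; push_cast; ring
  simp only [cosMoment, h]
  rw [intervalIntegral.integral_ofReal, show 4 = 2 + 2 from rfl, integral_cos_pow,
    integral_cos_sq]
  norm_num
  ring

/-! ### Inverting `w'' + w = f` on even antiperiodic functions. -/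

/-- Even and `π`-antiperiodic functions. -/
structure EvenAnti (f : ℝ → ℂ) : Prop where
  even : ∀ θ, f (-θ) = f θ
  anti : ∀ θ, f (θ + Real.pi) = -f θ

/-- The substitution `s ↦ π - s` reverses the sign of the integrand. Hence the sine resonance is
excluded by symmetry and only the cosine one has to be removed by hand. -/
theorem EvenAnti.integral_sin_mul {f : ℝ → ℂ} (hf : EvenAnti f) :
    ∫ s in (0 : ℝ)..Real.pi, (Real.sin s : ℂ) * f s = 0 := by
  have h := intervalIntegral.integral_comp_sub_left
    (a := 0) (b := Real.pi) (fun s : ℝ => (Real.sin s : ℂ) * f s) Real.pi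
  have h2 : ∀ s : ℝ, (Real.sin (Real.pi - s) : ℂ) * f (Real.pi - s) =
      -((Real.sin s : ℂ) * f s) := by
    intro s
    rw [Real.sin_pi_sub, show Real.pi - s = -s + Real.pi by ring, hf.anti, hf.even]
    ring
  simp only [h2, sub_self, sub_zero] at h
  rw [intervalIntegral.integral_neg] at h
  exact self_eq_neg.1 h.symm

theorem EvenAnti.cos_mul_periodic {f : ℝ → ℂ} (hf : EvenAnti f) :
    Function.Periodic (fun s : ℝ => (Real.cos s : ℂ) * f s) Real.pi := by
  intro s; simp only [hf.anti, Real.cos_add_pi]; push_cast; ring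

theorem EvenAnti.sin_mul_periodic {f : ℝ → ℂ} (hf : EvenAnti f) :
    Function.Periodic (fun s : ℝ => (Real.sin s : ℂ) * f s) Real.pi := by
  intro s; simp only [hf.anti, Real.sin_add_pi]; push_cast; ring

/-- The solution of `w'' + w = f` with vanishing Cauchy data at the origin. -/
def duhamel (f : ℝ → ℂ) (θ : ℝ) : ℂ :=
  (Real.sin θ : ℂ) * prim (fun s => (Real.cos s : ℂ) * f s) θ
    - (Real.cos θ : ℂ) * prim (fun s => (Real.sin s : ℂ) * f s) θ

theorem continuous_prim {g : ℝ → ℂ} (hg : Continuous g) : Continuous (prim g) :=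
  continuous_iff_continuousAt.2 fun θ => (hasDerivAt_prim hg θ).continuousAt

theorem continuous_duhamel {f : ℝ → ℂ} (hf : Continuous f) : Continuous (duhamel f) :=
  (continuous_sinC.mul (continuous_prim (continuous_cosC_mul hf))).sub
    (continuous_cosC.mul (continuous_prim (continuous_sinC_mul hf)))

/-- Products of `f` with sine or cosine are `π`-periodic; both have zero mean (the cosine one by
`h0`), so their primitives are periodic and the factors `sin θ`, `cos θ` supply the antiperiodicity.
-/
theorem evenAnti_duhamel {f : ℝ → ℂ} (hfc : Continuous f) (hf : EvenAnti f)
    (h0 : cosMoment f = 0) : EvenAnti (duhamel f) := by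
  have hA := prim_periodic (continuous_cosC_mul hfc) hf.cos_mul_periodic h0
  have hB := prim_periodic (continuous_sinC_mul hfc) hf.sin_mul_periodic hf.integral_sin_mul
  constructor
  · intro θ
    have h1 : prim (fun s => (Real.cos s : ℂ) * f s) (-θ) =
        -prim (fun s => (Real.cos s : ℂ) * f s) θ := by
      rw [prim_neg]; simp only [hf.even, Real.cos_neg]
    have h2 : prim (fun s => (Real.sin s : ℂ) * f s) (-θ) =
        prim (fun s => (Real.sin s : ℂ) * f s) θ := by
      rw [prim_neg]
      simp only [hf.even, Real.sin_neg, prim, Complex.ofReal_neg, neg_mul,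
        intervalIntegral.integral_neg, neg_neg]
    simp only [duhamel, h1, h2, Real.sin_neg, Real.cos_neg]
    push_cast; ring
  · intro θ
    simp only [duhamel, hA θ, hB θ, Real.sin_add_pi, Real.cos_add_pi]
    push_cast; ring

/-- The solution of `w'' + w = f` with vanishing cosine moment. -/
def green (f : ℝ → ℂ) (θ : ℝ) : ℂ :=
  duhamel f θ - (2 / Real.pi : ℝ) * cosMoment (duhamel f) * (Real.cos θ : ℂ)

/-- The derivative of `green f`. -/
def greenDeriv (f : ℝ → ℂ) (θ : ℝ) : ℂ :=
  (Real.cos θ : ℂ) * prim (fun s => (Real.cos s : ℂ) * f s) θ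
    + (Real.sin θ : ℂ) * prim (fun s => (Real.sin s : ℂ) * f s) θ
    + (2 / Real.pi : ℝ) * cosMoment (duhamel f) * (Real.sin θ : ℂ)

theorem hasDerivAt_cosC (θ : ℝ) :
    HasDerivAt (fun s : ℝ => (Real.cos s : ℂ)) (-(Real.sin θ : ℂ)) θ := by
  simpa using (Real.hasDerivAt_cos θ).ofReal_comp

theorem hasDerivAt_sinC (θ : ℝ) :
    HasDerivAt (fun s : ℝ => (Real.sin s : ℂ)) (Real.cos θ : ℂ) θ :=
  (Real.hasDerivAt_sin θ).ofReal_comp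

theorem hasDerivAt_green {f : ℝ → ℂ} (hf : Continuous f) (θ : ℝ) :
    HasDerivAt (green f) (greenDeriv f θ) θ := by
  have hA := hasDerivAt_prim (continuous_cosC_mul hf) θ
  have hB := hasDerivAt_prim (continuous_sinC_mul hf) θ
  have := (((hasDerivAt_sinC θ).fun_mul hA).fun_sub ((hasDerivAt_cosC θ).fun_mul hB)).fun_sub
    ((hasDerivAt_cosC θ).const_mul ((2 / Real.pi : ℝ) * cosMoment (duhamel f)))
  refine this.congr_deriv ?_
  simp only [greenDeriv]; ring

theorem hasDerivAt_greenDeriv {f : ℝ → ℂ} (hf : Continuous f) (θ : ℝ) :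
    HasDerivAt (greenDeriv f) (-green f θ + f θ) θ := by
  have hA := hasDerivAt_prim (continuous_cosC_mul hf) θ
  have hB := hasDerivAt_prim (continuous_sinC_mul hf) θ
  have := (((hasDerivAt_cosC θ).fun_mul hA).fun_add ((hasDerivAt_sinC θ).fun_mul hB)).fun_add
    ((hasDerivAt_sinC θ).const_mul ((2 / Real.pi : ℝ) * cosMoment (duhamel f)))
  refine this.congr_deriv ?_
  simp only [green, duhamel]
  have h1 : (Real.cos θ : ℂ) ^ 2 + (Real.sin θ : ℂ) ^ 2 = 1 := by
    have := Real.cos_sq_add_sin_sq θ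
    exact_mod_cast this
  linear_combination f θ * h1

theorem evenAnti_green {f : ℝ → ℂ} (hfc : Continuous f) (hf : EvenAnti f)
    (h0 : cosMoment f = 0) : EvenAnti (green f) := by
  have h := evenAnti_duhamel hfc hf h0
  constructor
  · intro θ; simp only [green, h.even, Real.cos_neg]
  · intro θ; simp only [green, h.anti, Real.cos_add_pi]; push_cast; ring

theorem cosMoment_green {f : ℝ → ℂ} (hf : Continuous f) : cosMoment (green f) = 0 := by
  have h := cosMoment_sub_mul (continuous_duhamel hf) continuous_cosC
    ((2 / Real.pi : ℝ) * cosMoment (duhamel f))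
  have h2 : ((2 / Real.pi : ℝ) : ℂ) * ((Real.pi / 2 : ℝ) : ℂ) = 1 := by
    rw [← Complex.ofReal_mul]
    have : 2 / Real.pi * (Real.pi / 2) = 1 := by field_simp
    rw [this, Complex.ofReal_one]
  rw [cosMoment_cos] at h
  refine h.trans ?_
  linear_combination -(cosMoment (duhamel f)) * h2

theorem norm_sinC_mul_le (s : ℝ) (z : ℂ) : ‖(Real.sin s : ℂ) * z‖ ≤ ‖z‖ := by
  rw [norm_mul]; exact mul_le_of_le_one_left (norm_nonneg _) (norm_sinC_le s)

theorem norm_cosC_mul_le (s : ℝ) (z : ℂ) : ‖(Real.cos s : ℂ) * z‖ ≤ ‖z‖ := by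
  rw [norm_mul]; exact mul_le_of_le_one_left (norm_nonneg _) (norm_cosC_le s)

theorem norm_prim_sin_le {f : ℝ → ℂ} (hfc : Continuous f) (hf : EvenAnti f)
    {C : ℝ} (hC0 : 0 ≤ C) (hC : ∀ s, ‖f s‖ ≤ C) (θ : ℝ) :
    ‖prim (fun s => (Real.sin s : ℂ) * f s) θ‖ ≤ Real.pi * C :=
  norm_prim_le (continuous_sinC_mul hfc) Real.pi_pos hf.sin_mul_periodic hf.integral_sin_mul hC0
    (fun s => (norm_sinC_mul_le s _).trans (hC s)) θ

section bounds

variable {f : ℝ → ℂ} (hfc : Continuous f) (hf : EvenAnti f) (h0 : cosMoment f = 0)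
  {C : ℝ} (hC0 : 0 ≤ C) (hC : ∀ s, ‖f s‖ ≤ C)

include hfc hf h0 hC0 hC

theorem norm_prim_cos_le (θ : ℝ) :
    ‖prim (fun s => (Real.cos s : ℂ) * f s) θ‖ ≤ Real.pi * C :=
  norm_prim_le (continuous_cosC_mul hfc) Real.pi_pos hf.cos_mul_periodic h0 hC0
    (fun s => (norm_cosC_mul_le s _).trans (hC s)) θ

theorem norm_duhamel_le (θ : ℝ) : ‖duhamel f θ‖ ≤ 2 * Real.pi * C := by
  have h1 := norm_prim_cos_le hfc hf h0 hC0 hC θ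
  have h2 := norm_prim_sin_le hfc hf hC0 hC θ
  refine (norm_sub_le _ _).trans ?_
  linarith [norm_sinC_mul_le θ (prim (fun s => (Real.cos s : ℂ) * f s) θ),
    norm_cosC_mul_le θ (prim (fun s => (Real.sin s : ℂ) * f s) θ)]

theorem norm_moment_duhamel_le :
    ‖((2 / Real.pi : ℝ) : ℂ) * cosMoment (duhamel f)‖ ≤ 4 * Real.pi * C := by
  have h := norm_cosMoment_le (norm_duhamel_le hfc hf h0 hC0 hC)
  rw [norm_mul, Complex.norm_real, Real.norm_of_nonneg (by positivity)]
  calc 2 / Real.pi * ‖cosMoment (duhamel f)‖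
      ≤ 2 / Real.pi * (Real.pi * (2 * Real.pi * C)) := by gcongr
    _ = 4 * Real.pi * C := by field_simp; ring

/-- The constant is `2π` for the Duhamel term plus `4π` for its projection onto the cosine. -/
theorem norm_green_le (θ : ℝ) : ‖green f θ‖ ≤ 6 * Real.pi * C := by
  have h1 := norm_duhamel_le hfc hf h0 hC0 hC θ
  have h2 := norm_moment_duhamel_le hfc hf h0 hC0 hC
  refine (norm_sub_le _ _).trans ?_
  rw [mul_comm _ (Real.cos θ : ℂ)]
  linarith [norm_cosC_mul_le θ (((2 / Real.pi : ℝ) : ℂ) * cosMoment (duhamel f))]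

theorem norm_greenDeriv_le (θ : ℝ) : ‖greenDeriv f θ‖ ≤ 6 * Real.pi * C := by
  have h1 := norm_prim_cos_le hfc hf h0 hC0 hC θ
  have h3 := norm_prim_sin_le hfc hf hC0 hC θ
  have h2 := norm_moment_duhamel_le hfc hf h0 hC0 hC
  refine (norm_add₃_le).trans ?_
  rw [mul_comm _ (Real.sin θ : ℂ)]
  linarith [norm_sinC_mul_le θ (((2 / Real.pi : ℝ) : ℂ) * cosMoment (duhamel f)),
    norm_cosC_mul_le θ (prim (fun s => (Real.cos s : ℂ) * f s) θ),
    norm_sinC_mul_le θ (prim (fun s => (Real.sin s : ℂ) * f s) θ)]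

end bounds

theorem prim_sub {f g : ℝ → ℂ} (hf : Continuous f) (hg : Continuous g) (θ : ℝ) :
    prim (fun s => f s - g s) θ = prim f θ - prim g θ :=
  intervalIntegral.integral_sub (hf.intervalIntegrable _ _) (hg.intervalIntegrable _ _)

theorem green_sub {f g : ℝ → ℂ} (hf : Continuous f) (hg : Continuous g) (θ : ℝ) :
    green (fun s => f s - g s) θ = green f θ - green g θ := by
  have hd : ∀ θ, duhamel (fun s => f s - g s) θ = duhamel f θ - 1 * duhamel g θ := by
    intro θ
    simp only [duhamel, mul_sub]
    rw [prim_sub (continuous_cosC_mul hf) (continuous_cosC_mul hg),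
      prim_sub (continuous_sinC_mul hf) (continuous_sinC_mul hg)]
    ring
  have hd' : duhamel (fun s => f s - g s) = fun θ => duhamel f θ - 1 * duhamel g θ :=
    funext hd
  simp only [green, hd']
  rw [cosMoment_sub_mul (continuous_duhamel hf) (continuous_duhamel hg)]
  ring

/-! ### The cubic forcing with its resonance removed. -/

/-- The cubic nonlinearity `|z|² z`. -/
def cub (z : ℂ) : ℂ := z * conj z * z

theorem norm_cub_sub_le {z w : ℂ} (hz : ‖z‖ ≤ 2) (hw : ‖w‖ ≤ 2) :
    ‖cub z - cub w‖ ≤ 12 * ‖z - w‖ := by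
  have h : cub z - cub w =
      (z - w) * (conj z * z) + w * conj (z - w) * z + w * conj w * (z - w) := by
    simp only [cub, map_sub]; ring
  rw [h]
  refine norm_add₃_le.trans ?_
  simp only [norm_mul, RCLike.norm_conj]
  have hzz : ‖z‖ * ‖z‖ ≤ 2 * 2 := by gcongr
  have hwz : ‖w‖ * ‖z‖ ≤ 2 * 2 := by gcongr
  have hww : ‖w‖ * ‖w‖ ≤ 2 * 2 := by gcongr
  nlinarith [norm_nonneg (z - w)]

theorem continuous_cub : Continuous cub := by unfold cub; fun_prop

theorem norm_cub_le {z : ℂ} (hz : ‖z‖ ≤ 2) : ‖cub z‖ ≤ 8 := by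
  simp only [cub, norm_mul, RCLike.norm_conj]
  calc ‖z‖ * ‖z‖ * ‖z‖ ≤ 2 * 2 * 2 := by gcongr
    _ = 8 := by norm_num

theorem cub_neg (z : ℂ) : cub (-z) = -cub z := by simp [cub]

/-- The multiplier removing the resonant part of the cubic nonlinearity. -/
def multiplier (u : ℝ → ℂ) : ℂ := (2 / Real.pi : ℝ) * cosMoment fun s => cub (u s)

/-- The cubic nonlinearity with its resonant part removed. -/
def forcing (u : ℝ → ℂ) (θ : ℝ) : ℂ := cub (u θ) - multiplier u * u θ

theorem continuous_forcing {u : ℝ → ℂ} (hu : Continuous u) : Continuous (forcing u) :=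
  (continuous_cub.comp hu).fun_sub (continuous_const.fun_mul hu)

theorem evenAnti_forcing {u : ℝ → ℂ} (hu : EvenAnti u) : EvenAnti (forcing u) := by
  constructor
  · intro θ; simp only [forcing, hu.even]
  · intro θ; simp only [forcing, hu.anti, cub_neg]; ring

/-- The normalization of the moment of `u` at the value of `cos` makes the solvability condition
linear in the multiplier, with an explicit solution. -/
theorem cosMoment_forcing {u : ℝ → ℂ} (hu : Continuous u)
    (h : cosMoment u = (Real.pi / 2 : ℝ)) : cosMoment (forcing u) = 0 := by
  have h1 := cosMoment_sub_mul (continuous_cub.comp hu) hu (multiplier u)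
  refine h1.trans ?_
  have h2 : ((2 / Real.pi : ℝ) : ℂ) * ((Real.pi / 2 : ℝ) : ℂ) = 1 := by
    rw [← Complex.ofReal_mul]
    have : 2 / Real.pi * (Real.pi / 2) = 1 := by field_simp
    rw [this, Complex.ofReal_one]
  rw [h, multiplier, Function.comp_def]
  linear_combination -(cosMoment fun s => cub (u s)) * h2

theorem norm_two_div_pi_mul_cosMoment_le {f : ℝ → ℂ} {C : ℝ} (hC : ∀ s, ‖f s‖ ≤ C) :
    ‖((2 / Real.pi : ℝ) : ℂ) * cosMoment f‖ ≤ 2 * C := by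
  have h := norm_cosMoment_le hC
  rw [norm_mul, Complex.norm_real, Real.norm_of_nonneg (by positivity)]
  calc 2 / Real.pi * ‖cosMoment f‖ ≤ 2 / Real.pi * (Real.pi * C) := by gcongr
    _ = 2 * C := by field_simp

theorem norm_multiplier_le {u : ℝ → ℂ} (hu : ∀ s, ‖u s‖ ≤ 2) : ‖multiplier u‖ ≤ 16 :=
  (norm_two_div_pi_mul_cosMoment_le fun s => norm_cub_le (hu s)).trans (by norm_num)

theorem norm_forcing_le {u : ℝ → ℂ} (hu : ∀ s, ‖u s‖ ≤ 2) (θ : ℝ) : ‖forcing u θ‖ ≤ 40 := by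
  refine (norm_sub_le _ _).trans ?_
  rw [norm_mul]
  have h1 : ‖multiplier u‖ * ‖u θ‖ ≤ 16 * 2 := by
    gcongr
    · exact norm_multiplier_le hu
    · exact hu θ
  linarith [norm_cub_le (hu θ)]

/-- The constant is `12 + 24 · 2 + 16`: the cubic term, the variation of the multiplier times `‖u‖ ≤
2`, and the multiplier times the variation of `u`. -/
theorem norm_forcing_sub_le {u w : ℝ → ℂ} (huc : Continuous u) (hwc : Continuous w)
    (hu : ∀ s, ‖u s‖ ≤ 2) (hw : ∀ s, ‖w s‖ ≤ 2) {C : ℝ} (hC : ∀ s, ‖u s - w s‖ ≤ C) (θ : ℝ) :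
    ‖forcing u θ - forcing w θ‖ ≤ 76 * C := by
  have hm : ‖multiplier u - multiplier w‖ ≤ 24 * C := by
    have h := cosMoment_sub_mul (continuous_cub.comp huc) (continuous_cub.comp hwc) 1
    have h2 : multiplier u - multiplier w =
        (2 / Real.pi : ℝ) * cosMoment fun s => cub (u s) - 1 * cub (w s) := by
      simp only [Function.comp_def] at h
      rw [h]; simp only [multiplier]; ring
    rw [h2]
    refine (norm_two_div_pi_mul_cosMoment_le (C := 12 * C) fun s => ?_).trans (by linarith)
    rw [one_mul]
    exact (norm_cub_sub_le (hu s) (hw s)).trans (by linarith [hC s])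
  have h : forcing u θ - forcing w θ = (cub (u θ) - cub (w θ))
      - (multiplier u - multiplier w) * u θ - multiplier w * (u θ - w θ) := by
    simp only [forcing]; ring
  rw [h]
  have h1 : ‖(multiplier u - multiplier w) * u θ‖ ≤ 24 * C * 2 := by
    rw [norm_mul]
    have := (norm_nonneg _).trans hm
    gcongr
    exact hu θ
  have h2 : ‖multiplier w * (u θ - w θ)‖ ≤ 16 * C := by
    rw [norm_mul]
    gcongr
    · exact norm_multiplier_le hw
    · exact hC θ
  have h3 := norm_cub_sub_le (hu θ) (hw θ)
  have h4 := norm_sub_le (cub (u θ) - cub (w θ) - (multiplier u - multiplier w) * u θ)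
    (multiplier w * (u θ - w θ))
  have h5 := norm_sub_le (cub (u θ) - cub (w θ)) ((multiplier u - multiplier w) * u θ)
  linarith [hC θ]

/-! ### The Banach space and the fixed-point map. -/

/-- Bounded even `π`-antiperiodic functions orthogonal to the cosine. -/
def symSpace : Submodule ℝ (ℝ →ᵇ ℂ) where
  carrier := {f | EvenAnti f ∧ cosMoment f = 0}
  zero_mem' := ⟨⟨fun _ => rfl, fun _ => by simp⟩, by simp [cosMoment]⟩
  add_mem' := by
    rintro f g ⟨hf, hf0⟩ ⟨hg, hg0⟩
    refine ⟨⟨fun θ => by simp [hf.even, hg.even], fun θ => ?_⟩, ?_⟩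
    · simp only [BoundedContinuousFunction.coe_add, Pi.add_apply, hf.anti, hg.anti]; ring
    · have h := cosMoment_sub_mul f.continuous g.continuous (-1)
      rw [hf0, hg0] at h
      rw [← (show (0 : ℂ) - -1 * 0 = 0 by simp), ← h]
      congr 1; ext s; simp
  smul_mem' := by
    rintro c f ⟨hf, hf0⟩
    refine ⟨⟨fun θ => by simp [hf.even], fun θ => by simp [hf.anti]⟩, ?_⟩
    have h := cosMoment_sub_mul (continuous_zero) f.continuous (-c)
    rw [hf0] at h
    have h0 : cosMoment 0 = 0 := by simp [cosMoment]
    rw [h0] at h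
    rw [← (show (0 : ℂ) - -c * 0 = 0 by simp), ← h]
    congr 1; ext s; simp

theorem mem_symSpace {f : ℝ →ᵇ ℂ} : f ∈ symSpace ↔ EvenAnti f ∧ cosMoment f = 0 := Iff.rfl

/-- Closedness gives completeness, hence the contraction principle; the moment is Lipschitz with
constant `π` in the sup norm. -/
theorem isClosed_symSpace : IsClosed (symSpace : Set (ℝ →ᵇ ℂ)) := by
  have hev : ∀ θ : ℝ, Continuous fun f : ℝ →ᵇ ℂ => f θ := fun θ =>
    continuous_eval_const θ
  have hm : Continuous fun f : ℝ →ᵇ ℂ => cosMoment f := by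
    refine (LipschitzWith.of_dist_le_mul (K := Real.pi.toNNReal) fun f g => ?_).continuous
    have h := cosMoment_sub_mul f.continuous g.continuous 1
    rw [dist_eq_norm, dist_eq_norm, Real.coe_toNNReal _ Real.pi_pos.le]
    rw [one_mul] at h
    rw [← h]
    refine norm_cosMoment_le fun s => ?_
    simpa using (f - g).norm_coe_le_norm s
  have : (symSpace : Set (ℝ →ᵇ ℂ)) = ((⋂ θ : ℝ, {f : ℝ →ᵇ ℂ | f (-θ) = f θ}) ∩
      ⋂ θ : ℝ, {f : ℝ →ᵇ ℂ | f (θ + Real.pi) = -f θ}) ∩ {f | cosMoment f = 0} := by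
    ext f
    simp only [SetLike.mem_coe, mem_symSpace, Set.mem_inter_iff, Set.mem_iInter,
      Set.mem_ofPred_eq]
    exact ⟨fun h => ⟨⟨h.1.even, h.1.anti⟩, h.2⟩, fun h => ⟨⟨h.1.1, h.1.2⟩, h.2⟩⟩
  rw [this]
  refine ((isClosed_iInter fun θ => isClosed_eq (hev _) (hev _)).inter
    (isClosed_iInter fun θ => isClosed_eq (hev _) (hev _).neg)).inter
    (isClosed_eq hm continuous_const)

instance : CompleteSpace symSpace := isClosed_symSpace.completeSpace_coe

/-- The perturbation `cos + v` of the cosine. -/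
def cosAdd (v : symSpace) (θ : ℝ) : ℂ := (Real.cos θ : ℂ) + v.1 θ

theorem continuous_cosAdd (v : symSpace) : Continuous (cosAdd v) :=
  continuous_cosC.add v.1.continuous

theorem evenAnti_cosAdd (v : symSpace) : EvenAnti (cosAdd v) := by
  constructor
  · intro θ; simp only [cosAdd, v.2.1.even, Real.cos_neg]
  · intro θ; simp only [cosAdd, v.2.1.anti, Real.cos_add_pi]; push_cast; ring

theorem cosMoment_cosAdd (v : symSpace) : cosMoment (cosAdd v) = (Real.pi / 2 : ℝ) := by
  have h := cosMoment_sub_mul continuous_cosC v.1.continuous (-1)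
  rw [v.2.2, cosMoment_cos] at h
  rw [← (show ((Real.pi / 2 : ℝ) : ℂ) - -1 * 0 = (Real.pi / 2 : ℝ) by simp), ← h]
  congr 1; ext s; simp [cosAdd]

theorem norm_cosAdd_le {v : symSpace} (hv : ‖v‖ ≤ 1) (s : ℝ) : ‖cosAdd v s‖ ≤ 2 := by
  have h1 := v.1.norm_coe_le_norm s
  have h2 : ‖v.1‖ ≤ 1 := hv
  refine (norm_add_le _ _).trans ?_
  linarith [norm_cosC_le s]

theorem continuous_green {f : ℝ → ℂ} (hf : Continuous f) : Continuous (green f) :=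
  continuous_iff_continuousAt.2 fun θ => (hasDerivAt_green hf θ).continuousAt

theorem exists_bound_of_evenAnti {f : ℝ → ℂ} (hfc : Continuous f) (hf : EvenAnti f) :
    ∃ C, 0 ≤ C ∧ ∀ s, ‖f s‖ ≤ C := by
  obtain ⟨C, hC⟩ := (isCompact_Icc (a := (0 : ℝ)) (b := Real.pi)).exists_bound_of_continuousOn
    hfc.continuousOn
  have hp : Function.Periodic (fun s => ‖f s‖) Real.pi := fun s => by simp [hf.anti]
  refine ⟨C, (norm_nonneg _).trans (hC 0 ⟨le_rfl, Real.pi_pos.le⟩), fun s => ?_⟩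
  obtain ⟨y, hy, hy'⟩ := hp.exists_mem_Ico₀ Real.pi_pos s
  exact hy'.trans_le (hC y ⟨hy.1, hy.2.le⟩)

/-- The nonlinear map of which `v` is a fixed point. -/
def fixMap (ν : ℂ) (v : symSpace) : symSpace :=
  have hc := continuous_forcing (continuous_cosAdd v)
  have he := evenAnti_forcing (evenAnti_cosAdd v)
  have h0 := cosMoment_forcing (continuous_cosAdd v) (cosMoment_cosAdd v)
  have hg := evenAnti_green hc he h0
  have hcont : Continuous fun θ => ν * green (forcing (cosAdd v)) θ :=
    continuous_const.mul (continuous_green hc)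
  have hea : EvenAnti fun θ => ν * green (forcing (cosAdd v)) θ :=
    ⟨fun θ => by rw [hg.even], fun θ => by rw [hg.anti]; ring⟩
  ⟨BoundedContinuousFunction.ofNormedAddCommGroup
    (fun θ => ν * green (forcing (cosAdd v)) θ) hcont
    (exists_bound_of_evenAnti hcont hea).choose
    (exists_bound_of_evenAnti hcont hea).choose_spec.2, hea, by
      have h := cosMoment_sub_mul continuous_zero (continuous_green hc) (-ν)
      have h0 : cosMoment 0 = 0 := by simp [cosMoment]
      rw [cosMoment_green hc, h0] at h
      rw [← (show (0 : ℂ) - -ν * 0 = 0 by simp), ← h]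
      congr 1; ext s; simp⟩

theorem fixMap_apply (ν : ℂ) (v : symSpace) (θ : ℝ) :
    (fixMap ν v).1 θ = ν * green (forcing (cosAdd v)) θ := rfl

theorem norm_fixMap_le (ν : ℂ) {v : symSpace} (hv : ‖v‖ ≤ 1) :
    ‖fixMap ν v‖ ≤ ‖ν‖ * (6 * Real.pi * 40) := by
  refine (BoundedContinuousFunction.norm_le (by positivity)).2 fun θ => ?_
  change ‖(fixMap ν v).1 θ‖ ≤ _
  rw [fixMap_apply, norm_mul]
  gcongr
  exact norm_green_le (continuous_forcing (continuous_cosAdd v))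
    (evenAnti_forcing (evenAnti_cosAdd v))
    (cosMoment_forcing (continuous_cosAdd v) (cosMoment_cosAdd v)) (by norm_num)
    (norm_forcing_le (norm_cosAdd_le hv)) θ

/-- Linearity of the Green operator reduces this to the Lipschitz bound on the forcing. The
difference of two forcings is again symmetric and non-resonant, so the same operator bound applies.
-/
theorem norm_fixMap_sub_le (ν : ℂ) {v w : symSpace} (hv : ‖v‖ ≤ 1) (hw : ‖w‖ ≤ 1) :
    ‖fixMap ν v - fixMap ν w‖ ≤ ‖ν‖ * (6 * Real.pi * 76) * ‖v - w‖ := by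
  refine (BoundedContinuousFunction.norm_le (by positivity)).2 fun θ => ?_
  have hcv := continuous_forcing (continuous_cosAdd v)
  have hcw := continuous_forcing (continuous_cosAdd w)
  have hev := evenAnti_forcing (evenAnti_cosAdd v)
  have hew := evenAnti_forcing (evenAnti_cosAdd w)
  have h0 := cosMoment_sub_mul hcv hcw 1
  rw [cosMoment_forcing (continuous_cosAdd v) (cosMoment_cosAdd v),
    cosMoment_forcing (continuous_cosAdd w) (cosMoment_cosAdd w)] at h0
  have h1 : (fixMap ν v - fixMap ν w).1 θ =
      ν * green (fun s => forcing (cosAdd v) s - forcing (cosAdd w) s) θ := by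
    rw [green_sub hcv hcw, mul_sub]; rfl
  change ‖(fixMap ν v - fixMap ν w).1 θ‖ ≤ _
  rw [h1, norm_mul, mul_assoc, mul_assoc (6 * Real.pi)]
  gcongr
  refine norm_green_le (hcv.fun_sub hcw) ⟨fun s => ?_, fun s => ?_⟩ ?_ (by positivity) ?_ θ
  · rw [hev.even, hew.even]
  · rw [hev.anti, hew.anti]; ring
  · simpa using h0
  · refine norm_forcing_sub_le (continuous_cosAdd v) (continuous_cosAdd w) (norm_cosAdd_le hv)
      (norm_cosAdd_le hw) fun s => ?_
    have : cosAdd v s - cosAdd w s = (v - w).1 s := by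
      simp [cosAdd]
    rw [this]
    exact (v - w).1.norm_coe_le_norm s

/-! ### Joint continuity and the bifurcating family of profiles. -/

theorem continuous_prim_uncurry {X : Type*} [TopologicalSpace X] {f : X → ℝ → ℂ}
    (hf : Continuous (Function.uncurry f)) : Continuous fun p : X × ℝ => prim (f p.1) p.2 :=
  intervalIntegral.continuous_parametric_intervalIntegral_of_continuous
    (f := fun (p : X × ℝ) s => f p.1 s)
    (hf.comp (by fun_prop : Continuous fun q : (X × ℝ) × ℝ => (q.1.1, q.2))) continuous_snd

theorem continuous_cosMoment {X : Type*} [TopologicalSpace X] {f : X → ℝ → ℂ}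
    (hf : Continuous (Function.uncurry f)) : Continuous fun x => cosMoment (f x) :=
  intervalIntegral.continuous_parametric_intervalIntegral_of_continuous'
    (f := fun x s => (Real.cos s : ℂ) * f x s)
    ((continuous_cosC.comp continuous_snd).mul hf) 0 Real.pi

theorem continuous_greenDeriv_uncurry {X : Type*} [TopologicalSpace X] {f : X → ℝ → ℂ}
    (hf : Continuous (Function.uncurry f)) :
    Continuous fun p : X × ℝ => greenDeriv (f p.1) p.2 := by
  have hA := continuous_prim_uncurry (f := fun x s => (Real.cos s : ℂ) * f x s)
    ((continuous_cosC.comp continuous_snd).mul hf)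
  have hB := continuous_prim_uncurry (f := fun x s => (Real.sin s : ℂ) * f x s)
    ((continuous_sinC.comp continuous_snd).mul hf)
  have hc : Continuous fun p : X × ℝ => (Real.cos p.2 : ℂ) := continuous_cosC.comp continuous_snd
  have hs : Continuous fun p : X × ℝ => (Real.sin p.2 : ℂ) := continuous_sinC.comp continuous_snd
  have hD : Continuous fun p : X × ℝ => duhamel (f p.1) p.2 := (hs.mul hA).sub (hc.mul hB)
  have hM := (continuous_cosMoment (f := fun x => duhamel (f x)) hD).comp
    (continuous_fst (X := X) (Y := ℝ))
  exact ((hc.mul hA).add (hs.mul hB)).add ((continuous_const.mul hM).mul hs)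

/-- The nonlinear oscillator whose solutions are the profiles. -/
def profileRHS (ν r : ℂ) (t : ℝ) (z : ℂ) : ℂ := -(1 + t * ν * r) * z + t * ν * cub z

/-- A family of even antiperiodic solutions bifurcating from the cosine. -/
theorem exists_even_profile (ν : ℂ) : ∃ t₀ > (0 : ℝ), ∃ (u u' : ℝ → ℝ → ℂ) (r : ℝ → ℂ),
    Continuous (Function.uncurry u) ∧ Continuous (Function.uncurry u') ∧ Continuous r ∧
    (∀ θ, u 0 θ = (Real.cos θ : ℂ)) ∧ (∀ θ, u' 0 θ = -(Real.sin θ : ℂ)) ∧ r 0 = 3 / 4 ∧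
    ∀ t, |t| ≤ t₀ → (∀ θ, HasDerivAt (u t) (u' t θ) θ) ∧
      (∀ θ, HasDerivAt (u' t) (profileRHS ν (r t) t (u t θ)) θ) ∧
      EvenAnti (u t) ∧ ∀ θ, ‖u' t θ + (Real.sin θ : ℂ)‖ ≤ 1 / 2 := by
  obtain ⟨t₁, ht₁, v, hvc, hv⟩ := exists_continuous_fixedPoint (fixMap ν)
    (M := ‖ν‖ * (6 * Real.pi * 40)) (L := ‖ν‖ * (6 * Real.pi * 76)) (by positivity)
    (by positivity) (fun v hv => norm_fixMap_le ν hv)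
    (fun v w hv hw => norm_fixMap_sub_le ν hv hw)
  obtain ⟨K, hK⟩ : ∃ K : ℝ, K = ‖ν‖ * (6 * Real.pi * 40) := ⟨_, rfl⟩
  have hK0 : 0 ≤ K := by rw [hK]; positivity
  have hK1 : 0 < 1 / (2 * (K + 1)) := by positivity
  have hvu : Continuous (Function.uncurry fun t => cosAdd (v t)) := by
    have h1 : Continuous fun p : ℝ × ℝ => (v p.1).1 p.2 :=
      (continuous_subtype_val.comp (hvc.comp continuous_fst)).eval continuous_snd
    exact (continuous_cosC.comp continuous_snd).add h1
  have hr : Continuous fun t => multiplier (cosAdd (v t)) :=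
    continuous_const.mul (continuous_cosMoment (f := fun t s => cub (cosAdd (v t) s))
      (continuous_cub.comp hvu))
  have hf : Continuous (Function.uncurry fun t => forcing (cosAdd (v t))) :=
    (continuous_cub.comp hvu).sub ((hr.comp continuous_fst).mul hvu)
  have hv0 : v 0 = 0 := by
    have := (hv 0 (by simpa using ht₁.le)).2
    simpa using this
  have hcos0 : cosAdd (v 0) = fun θ => (Real.cos θ : ℂ) := by
    ext θ; simp [cosAdd, hv0]
  -- The second bound forces `|t| K ≤ 1 / 2`, which keeps `u'` within `1 / 2` of `-sin`, as the
  -- polar decomposition requires.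
  refine ⟨min t₁ (1 / (2 * (K + 1))), lt_min ht₁ hK1, fun t => cosAdd (v t),
    fun t θ => -(Real.sin θ : ℂ) + t * (ν * greenDeriv (forcing (cosAdd (v t))) θ),
    fun t => multiplier (cosAdd (v t)), hvu, ?_, hr, ?_, ?_, ?_, ?_⟩
  · have hs : Continuous fun p : ℝ × ℝ => (Real.sin p.2 : ℂ) :=
      continuous_sinC.comp continuous_snd
    have ht : Continuous fun p : ℝ × ℝ => (p.1 : ℂ) :=
      Complex.continuous_ofReal.comp continuous_fst
    have hg := continuous_greenDeriv_uncurry (f := fun t => forcing (cosAdd (v t))) hf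
    exact hs.fun_neg.fun_add (ht.fun_mul (hg.const_mul ν))
  · intro θ; exact congrFun hcos0 θ
  · intro θ; simp
  -- At `t = 0` the multiplier is `(2 / π) ∫ cos⁴` over half a period, i.e. `(2 / π)(3π / 8) = 3 /
  -- 4`.
  · have : (fun s : ℝ => cub (Real.cos s : ℂ)) = fun s => (Real.cos s : ℂ) ^ 3 := by
      ext s; simp only [cub, Complex.conj_ofReal]; ring
    simp only [multiplier, hcos0, this, cosMoment_cos_cube]
    rw [← Complex.ofReal_mul]
    have : 2 / Real.pi * (3 * Real.pi / 8) = 3 / 4 := by field_simp; norm_num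
    rw [this]; push_cast; rfl
  · intro t ht
    obtain ⟨hv1, hv2⟩ := hv t (ht.trans (min_le_left _ _))
    have hc := continuous_forcing (continuous_cosAdd (v t))
    have heq : ∀ θ, cosAdd (v t) θ =
        (Real.cos θ : ℂ) + t * (ν * green (forcing (cosAdd (v t))) θ) := by
      intro θ
      have : (v t).1 θ = t * (ν * green (forcing (cosAdd (v t))) θ) := by
        conv_lhs => rw [hv2]
        simp [fixMap_apply]
      conv_lhs => rw [cosAdd, this]
    refine ⟨fun θ => ?_, fun θ => ?_, evenAnti_cosAdd (v t), fun θ => ?_⟩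
    · have h := (hasDerivAt_cosC θ).add
        (((hasDerivAt_green hc θ).const_mul ν).const_mul (t : ℂ))
      refine h.congr_of_eventuallyEq (Filter.Eventually.of_forall fun s => ?_)
      exact heq s
    · have h := (hasDerivAt_sinC θ).neg.add
        (((hasDerivAt_greenDeriv hc θ).const_mul ν).const_mul (t : ℂ))
      refine h.congr_deriv ?_
      have h1 := heq θ
      simp only [profileRHS]
      simp only [forcing] at h1 ⊢
      linear_combination h1
    · have hg := norm_greenDeriv_le hc (evenAnti_forcing (evenAnti_cosAdd (v t)))
        (cosMoment_forcing (continuous_cosAdd _) (cosMoment_cosAdd _)) (by norm_num)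
        (norm_forcing_le (norm_cosAdd_le hv1)) θ
      have ht2 := ht.trans (min_le_right _ _)
      beta_reduce
      rw [neg_add_eq_sub, sub_add_cancel, norm_mul, norm_mul, Complex.norm_real,
        Real.norm_eq_abs]
      calc |t| * (‖ν‖ * ‖greenDeriv (forcing (cosAdd (v t))) θ‖)
          ≤ 1 / (2 * (K + 1)) * (‖ν‖ * (6 * Real.pi * 40)) := by gcongr
        _ = K / (K + 1) * (1 / 2) := by rw [← hK]; field_simp
        _ ≤ 1 * (1 / 2) := by
            gcongr
            rw [div_le_one (by positivity)]; linarith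
        _ = 1 / 2 := by norm_num

/-! ### Polar decomposition across zeros. -/

/-- Division of a `C³` function by the variable. -/
theorem exists_contDiff_div {E : Type*} [NormedAddCommGroup E] [NormedSpace ℝ E]
    [CompleteSpace E] {f : ℝ → E} (hf : ContDiff ℝ 3 f) {c : ℝ} (hc : f c = 0) :
    ∃ g : ℝ → E, ContDiff ℝ 2 g ∧ g c = deriv f c ∧ ∀ x, f x = (x - c) • g x := by
  -- Hadamard's quotient is the average of `f'` over the segment from `c` to `x`. Each
  -- differentiation under the integral brings out a factor `s`, so the induction must allow an
  -- arbitrary weight `s ^ k`.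
  have key : ∀ (n : ℕ) (k : ℕ) (g : ℝ → E), ContDiff ℝ n g →
      ContDiff ℝ n fun x => ∫ s in (0 : ℝ)..1, s ^ k • g (c + s * (x - c)) := by
    intro n
    induction n with
    | zero =>
      intro k g hg
      have hg' : Continuous g := hg.continuous
      rw [Nat.cast_zero, contDiff_zero]
      exact intervalIntegral.continuous_parametric_intervalIntegral_of_continuous'
        (f := fun x s => s ^ k • g (c + s * (x - c))) (by fun_prop) 0 1
    | succ n ih =>
      intro k g hg
      have hg1 : ContDiff ℝ n (deriv g) := by
        have := (contDiff_succ_iff_deriv (n := n)).1 (by exact_mod_cast hg)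
        exact this.2.2
      have hgd : Differentiable ℝ g := hg.differentiable (by simp)
      have hgc : Continuous g := hg.continuous
      have hg1c : Continuous (deriv g) := hg1.continuous
      have hd : ∀ x, HasDerivAt (fun x => ∫ s in (0 : ℝ)..1, s ^ k • g (c + s * (x - c)))
          (∫ s in (0 : ℝ)..1, s ^ (k + 1) • deriv g (c + s * (x - c))) x := by
        intro x
        have hcont : Continuous fun p : ℝ × ℝ => p.2 ^ (k + 1) • deriv g (c + p.2 * (p.1 - c)) := by
          fun_prop
        obtain ⟨C, hC⟩ := ((isCompact_closedBall x 1).prod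
          (isCompact_Icc (a := (0 : ℝ)) (b := 1))).exists_bound_of_continuousOn hcont.continuousOn
        refine (intervalIntegral.hasDerivAt_integral_of_dominated_loc_of_deriv_le
          (F := fun x s => s ^ k • g (c + s * (x - c)))
          (F' := fun x s => s ^ (k + 1) • deriv g (c + s * (x - c)))
          (bound := fun _ => C) (s := Metric.closedBall x 1)
          (Metric.closedBall_mem_nhds x one_pos) ?_ ?_ ?_ ?_ ?_ ?_).2
        · refine Filter.Eventually.of_forall fun y => ?_
          exact (by fun_prop : Continuous fun s : ℝ =>
            s ^ k • g (c + s * (y - c))).aestronglyMeasurable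
        · exact (by fun_prop : Continuous fun s : ℝ =>
            s ^ k • g (c + s * (x - c))).intervalIntegrable _ _
        · exact (by fun_prop : Continuous fun s : ℝ =>
            s ^ (k + 1) • deriv g (c + s * (x - c))).aestronglyMeasurable
        · refine Filter.Eventually.of_forall fun s hs y hy => ?_
          rw [Set.uIoc_of_le zero_le_one] at hs
          exact hC (y, s) ⟨hy, hs.1.le, hs.2⟩
        · simp
        · refine Filter.Eventually.of_forall fun s _ y _ => ?_
          have h1 : HasDerivAt (fun y => c + s * (y - c)) s y := by
            simpa using (((hasDerivAt_id y).sub_const c).const_mul s).const_add c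
          have h2 := ((hgd (c + s * (y - c))).hasDerivAt.scomp y h1).const_smul (s ^ k)
          refine h2.congr_deriv ?_
          rw [smul_smul, pow_succ]
      have : ContDiff ℝ ((n : ℕ∞) + 1) fun x =>
          ∫ s in (0 : ℝ)..1, s ^ k • g (c + s * (x - c)) := by
        refine (contDiff_succ_iff_deriv (n := n)).2 ⟨fun x => (hd x).differentiableAt, ?_, ?_⟩
        · simp
        · have : (deriv fun x => ∫ s in (0 : ℝ)..1, s ^ k • g (c + s * (x - c))) = _ :=
            funext fun x => (hd x).deriv
          rw [this]
          exact ih (k + 1) (deriv g) hg1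
      exact_mod_cast this
  have hf1 : ContDiff ℝ 2 (deriv f) := by
    have := (contDiff_succ_iff_deriv (n := 2)).1 (by norm_num; exact hf)
    exact this.2.2
  have hfd : Differentiable ℝ f := hf.differentiable (by simp)
  refine ⟨fun x => ∫ s in (0 : ℝ)..1, s ^ 0 • deriv f (c + s * (x - c)),
    key 2 0 (deriv f) hf1, ?_, fun x => ?_⟩
  · simp
  · have hf1c : Continuous (deriv f) := hf1.continuous
    rw [← intervalIntegral.integral_smul]
    have h := intervalIntegral.integral_eq_sub_of_hasDerivAt (a := 0) (b := 1)
      (f := fun s : ℝ => f (c + s * (x - c)))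
      (f' := fun s => (x - c) • s ^ 0 • deriv f (c + s * (x - c))) (fun s _ => ?_) ?_
    · rw [h]; simp [hc]
    · have h1 : HasDerivAt (fun s => c + s * (x - c)) (x - c) s := by
        simpa using ((hasDerivAt_id s).mul_const (x - c)).const_add c
      simpa [Function.comp_def] using (hfd (c + s * (x - c))).hasDerivAt.scomp s h1
    · exact (by fun_prop : Continuous fun s : ℝ =>
        (x - c) • s ^ 0 • deriv f (c + s * (x - c))).intervalIntegrable _ _

theorem contDiff_succ_of_hasDerivAt {f f' : ℝ → ℂ} {n : ℕ} (h : ∀ x, HasDerivAt f (f' x) x)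
    (hf' : ContDiff ℝ n f') : ContDiff ℝ (n + 1) f := by
  refine (contDiff_succ_iff_deriv (n := n)).2 ⟨fun x => (h x).differentiableAt, by simp, ?_⟩
  rwa [show deriv f = f' from funext fun x => (h x).deriv]

theorem contDiff_cub : ContDiff ℝ ⊤ cub :=
  (contDiff_id.mul Complex.conjCLE.contDiff).mul contDiff_id

/-- Bootstrapping the equation. Three derivatives are needed because dividing by the cosine costs
one. -/
theorem contDiff_profile {ν r : ℂ} {t : ℝ} {u u' : ℝ → ℂ}
    (hu : ∀ θ, HasDerivAt u (u' θ) θ)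
    (hu' : ∀ θ, HasDerivAt u' (profileRHS ν r t (u θ)) θ) : ContDiff ℝ 3 u := by
  have hR : ContDiff ℝ ⊤ (profileRHS ν r t) :=
    (contDiff_const.mul contDiff_id).add (contDiff_const.mul contDiff_cub)
  have hc : ContDiff ℝ (0 : ℕ) u' := by
    rw [Nat.cast_zero, contDiff_zero]
    exact continuous_iff_continuousAt.2 fun θ => (hu' θ).continuousAt
  have h1 : ContDiff ℝ (1 : ℕ) u := by
    have := contDiff_succ_of_hasDerivAt hu hc
    exact_mod_cast this
  have h2 : ContDiff ℝ (2 : ℕ) u' := by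
    have := contDiff_succ_of_hasDerivAt hu' ((hR.of_le (by simp)).comp h1)
    exact_mod_cast this
  have h3 := contDiff_succ_of_hasDerivAt hu h2
  exact_mod_cast h3

/-- Evenness and antiperiodicity give `u (π / 2) = -u (π / 2)`; the other zeros of the cosine follow
by translation. The zeros thus stay in place along the family. -/
theorem EvenAnti.eq_zero_of_cos_eq_zero {u : ℝ → ℂ} (hu : EvenAnti u) {θ : ℝ}
    (hθ : Real.cos θ = 0) : u θ = 0 := by
  have hp : Function.Periodic (fun s => (‖u s‖, |Real.cos s|)) Real.pi := fun s => by
    simp [hu.anti, Real.cos_add_pi]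
  obtain ⟨y, hy, hy'⟩ := hp.exists_mem_Ico₀ Real.pi_pos θ
  simp only [hθ, abs_zero, Prod.mk.injEq] at hy'
  have hy2 : y = Real.pi / 2 := by
    refine Real.injOn_cos ⟨hy.1, hy.2.le⟩
      ⟨by linarith [Real.pi_pos], by linarith [Real.pi_pos]⟩ ?_
    rw [Real.cos_pi_div_two]; exact abs_eq_zero.1 hy'.2.symm
  have h2 : u (Real.pi / 2) = 0 := by
    have h := hu.anti (-(Real.pi / 2))
    rw [show -(Real.pi / 2) + Real.pi = Real.pi / 2 by ring, hu.even] at h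
    exact self_eq_neg.1 h
  rw [hy2, h2, norm_zero] at hy'
  exact norm_eq_zero.1 hy'.1

/-- The quotient of a profile by the cosine. -/
def cosQuot (u u' : ℝ → ℂ) (θ : ℝ) : ℂ :=
  if Real.cos θ = 0 then -u' θ / (Real.sin θ : ℂ) else u θ / (Real.cos θ : ℂ)

theorem deriv_antiperiodic {u u' : ℝ → ℂ} (hu : ∀ θ, HasDerivAt u (u' θ) θ)
    (hper : ∀ θ, u (θ + Real.pi) = -u θ) (θ : ℝ) : u' (θ + Real.pi) = -u' θ := by
  have h1 := (hu (θ + Real.pi)).comp_add_const θ Real.pi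
  rw [show (fun s => u (s + Real.pi)) = fun s => -u s from funext hper] at h1
  exact h1.unique (hu θ).neg

section cosQuot

variable {u u' : ℝ → ℂ} (hu : ∀ θ, HasDerivAt u (u' θ) θ) (he : EvenAnti u)

include he in
theorem cos_mul_cosQuot (θ : ℝ) : u θ = (Real.cos θ : ℂ) * cosQuot u u' θ := by
  by_cases h : Real.cos θ = 0
  · rw [he.eq_zero_of_cos_eq_zero h, h]; simp
  · rw [cosQuot, if_neg h, mul_div_cancel₀]
    exact_mod_cast h

include hu he

theorem EvenAnti.deriv_neg (θ : ℝ) : u' (-θ) = -u' θ := by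
  have h1 : HasDerivAt (fun s => u (-s)) (-u' (-θ)) θ := by
    simpa [Function.comp_def] using (hu (-θ)).scomp θ (hasDerivAt_neg θ)
  rw [show (fun s => u (-s)) = u from funext he.even] at h1
  rw [← h1.unique (hu θ), neg_neg]

theorem cosQuot_neg (θ : ℝ) : cosQuot u u' (-θ) = cosQuot u u' θ := by
  simp only [cosQuot, Real.cos_neg, he.even, he.deriv_neg hu, Real.sin_neg, Complex.ofReal_neg,
    div_neg, neg_div, neg_neg]

theorem cosQuot_periodic : Function.Periodic (cosQuot u u') Real.pi := by
  intro θ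
  simp only [cosQuot, Real.cos_add_pi, he.anti, deriv_antiperiodic hu he.anti, Real.sin_add_pi,
    Complex.ofReal_neg, div_neg, neg_div, neg_neg, neg_eq_zero]

/-- Near a zero `c` of the cosine, both numerator and denominator are `x - c` times a `C²` function,
and the second cofactor is `-sin c ≠ 0` at `c`. This is also why the value assigned there is the
l'Hôpital limit. -/
theorem contDiff_cosQuot (hu3 : ContDiff ℝ 3 u) : ContDiff ℝ 2 (cosQuot u u') := by
  rw [contDiff_iff_contDiffAt]
  intro c
  have hcosC : ContDiff ℝ 3 fun s : ℝ => (Real.cos s : ℂ) :=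
    Complex.ofRealCLM.contDiff.comp Real.contDiff_cos
  by_cases h : Real.cos c = 0
  · obtain ⟨g, hg, hgc, hg'⟩ := exists_contDiff_div hu3 (he.eq_zero_of_cos_eq_zero h)
    obtain ⟨k, hk, hkc, hk'⟩ := exists_contDiff_div hcosC (c := c)
      (by rw [h, Complex.ofReal_zero])
    rw [(hu c).deriv] at hgc
    rw [(hasDerivAt_cosC c).deriv] at hkc
    have hs : (Real.sin c : ℂ) ≠ 0 := by
      have := Real.cos_sq_add_sin_sq c
      rw [h] at this
      intro h0
      rw [Complex.ofReal_eq_zero.1 h0] at this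
      norm_num at this
    have hk0 : k c ≠ 0 := by rw [hkc]; exact neg_ne_zero.2 hs
    have hev : ∀ᶠ x in nhds c, k x ≠ 0 := hk.continuous.continuousAt.eventually_ne hk0
    refine ((hg.contDiffAt (x := c)).mul (hk.contDiffAt.inv hk0)).congr_of_eventuallyEq ?_
    filter_upwards [hev] with x hx
    rw [Pi.inv_apply, ← div_eq_mul_inv]
    by_cases hxc : x = c
    · subst hxc
      simp only [cosQuot, if_pos h, hgc, hkc, div_neg, neg_div]
    · have hx0 : (x - c : ℝ) ≠ 0 := sub_ne_zero.2 hxc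
      have hcx : (Real.cos x : ℂ) ≠ 0 := by
        rw [hk']; exact smul_ne_zero hx0 hx
      rw [cosQuot, if_neg (by exact_mod_cast hcx), hk', hg', Complex.real_smul, Complex.real_smul,
        mul_div_mul_left]
      exact_mod_cast hx0
  · have hev : ∀ᶠ x in nhds c, Real.cos x ≠ 0 :=
      Real.continuous_cos.continuousAt.eventually_ne h
    have hcc : (Real.cos c : ℂ) ≠ 0 := by exact_mod_cast h
    refine (((hu3.of_le (m := 2) (by norm_num)).contDiffAt (x := c)).mul
      ((hcosC.of_le (m := 2) (by norm_num)).contDiffAt.inv hcc)).congr_of_eventuallyEq ?_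
    filter_upwards [hev] with x hx
    rw [cosQuot, if_neg hx, div_eq_mul_inv, Pi.inv_apply]

/-- Symmetry reduces to `0 ≤ y ≤ π / 2`. There the mean value inequality from `π / 2` gives `|u -
cos| ≤ (π / 2 - y) / 2`, Jordan's inequality gives `cos y ≥ (2 / π)(π / 2 - y)`, and `1 / 2 < 2 / π`
because `π < 4`. -/
theorem norm_cosQuot_sub_one_lt (hb : ∀ θ, ‖u' θ + (Real.sin θ : ℂ)‖ ≤ 1 / 2) (θ : ℝ) :
    ‖cosQuot u u' θ - 1‖ < 1 := by
  have main : ∀ y : ℝ, 0 ≤ y → y ≤ Real.pi / 2 → ‖cosQuot u u' y - 1‖ < 1 := by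
    intro y hy0 hy1
    rcases hy1.eq_or_lt with rfl | hy1
    · have h := hb (Real.pi / 2)
      simp only [cosQuot, Real.cos_pi_div_two, if_true, Real.sin_pi_div_two, Complex.ofReal_one,
        div_one] at h ⊢
      rw [← norm_neg, show -(-u' (Real.pi / 2) - 1) = u' (Real.pi / 2) + 1 by ring]
      linarith
    · have hd : ∀ s, HasDerivAt (fun s : ℝ => u s - (Real.cos s : ℂ))
          (u' s + (Real.sin s : ℂ)) s := fun s => by
        simpa using (hu s).fun_sub (hasDerivAt_cosC s)
      have h1 := convex_univ.norm_image_sub_le_of_norm_hasDerivWithin_le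
        (fun s _ => (hd s).hasDerivWithinAt) (fun s _ => hb s)
        (Set.mem_univ (Real.pi / 2)) (Set.mem_univ y)
      rw [he.eq_zero_of_cos_eq_zero Real.cos_pi_div_two, Real.cos_pi_div_two] at h1
      simp only [Complex.ofReal_zero, sub_zero, Real.norm_eq_abs] at h1
      rw [abs_sub_comm, abs_of_pos (by linarith : (0 : ℝ) < Real.pi / 2 - y)] at h1
      have h2 := Real.mul_le_sin (by linarith : 0 ≤ Real.pi / 2 - y) (by linarith)
      rw [Real.sin_pi_div_two_sub] at h2
      have hpos : 0 < Real.cos y :=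
        Real.cos_pos_of_mem_Ioo ⟨by linarith [Real.pi_pos], hy1⟩
      have hne : (Real.cos y : ℂ) ≠ 0 := by exact_mod_cast hpos.ne'
      rw [cosQuot, if_neg hpos.ne', div_sub_one hne, norm_div, Complex.norm_real,
        Real.norm_of_nonneg hpos.le, div_lt_one hpos]
      refine h1.trans_lt (lt_of_lt_of_le ?_ h2)
      have hpi : 1 / 2 < 2 / Real.pi := by
        rw [div_lt_div_iff₀ (by norm_num) Real.pi_pos]
        linarith [Real.pi_lt_four]
      exact mul_lt_mul_of_pos_right hpi (by linarith)
  obtain ⟨y, hy, hy'⟩ := (cosQuot_periodic hu he).exists_mem_Ico Real.pi_pos θ (-(Real.pi / 2))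
  rw [hy']
  have habs : cosQuot u u' y = cosQuot u u' |y| := by
    rcases abs_choice y with h | h
    · rw [h]
    · rw [h, cosQuot_neg hu he]
  rw [habs]
  exact main _ (abs_nonneg y) (abs_le.2 ⟨hy.1, by linarith [hy.2]⟩)

/-- Smooth polar decomposition of a profile across its zeros. -/
theorem exists_polar (hu3 : ContDiff ℝ 3 u) (hb : ∀ θ, ‖u' θ + (Real.sin θ : ℂ)‖ ≤ 1 / 2) :
    ∃ ρ ψ : ℝ → ℝ, ContDiff ℝ 2 ρ ∧ ContDiff ℝ 2 ψ ∧ (∀ θ, ρ θ ≠ 0) ∧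
      (∀ θ, u θ = ((Real.cos θ * ρ θ : ℝ) : ℂ) * Complex.exp (Complex.I * (ψ θ : ℂ))) ∧
      (∀ θ, ρ (-θ) = ρ θ) ∧ (∀ θ, ψ (-θ) = ψ θ) ∧
      Function.Periodic ρ Real.pi ∧ Function.Periodic ψ Real.pi := by
  -- Staying in the slit plane makes the principal logarithm smooth along the quotient, so the phase
  -- needs no lifting and inherits its parity and period.
  have hsl : ∀ θ, cosQuot u u' θ ∈ Complex.slitPlane := fun θ => by
    have := Complex.mem_slitPlane_of_norm_lt_one (norm_cosQuot_sub_one_lt hu he hb θ)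
    rwa [add_sub_cancel] at this
  have hne : ∀ θ, cosQuot u u' θ ≠ 0 := fun θ => Complex.slitPlane_ne_zero (hsl θ)
  have hC := contDiff_cosQuot hu he hu3
  refine ⟨fun θ => ‖cosQuot u u' θ‖, fun θ => (Complex.log (cosQuot u u' θ)).im,
    hC.norm ℝ hne, ?_, fun θ => norm_ne_zero_iff.2 (hne θ), fun θ => ?_,
    fun θ => by simp only [cosQuot_neg hu he], fun θ => by simp only [cosQuot_neg hu he],
    fun θ => by simp only [cosQuot_periodic hu he θ], fun θ => by
      simp only [cosQuot_periodic hu he θ]⟩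
  · refine Complex.imCLM.contDiff.comp (f := fun θ => Complex.log (cosQuot u u' θ))
      (contDiff_iff_contDiffAt.2 fun θ => ?_)
    exact ((Complex.contDiffAt_log (hsl θ)).restrict_scalars ℝ).comp θ hC.contDiffAt
  · beta_reduce
    rw [Complex.log_im, mul_comm Complex.I, Complex.ofReal_mul, mul_assoc,
      Complex.norm_mul_exp_arg_mul_I]
    exact cos_mul_cosQuot he θ

end cosQuot

/-! ### Both parities by a quarter-period shift. -/

/-- The profiles of both parities, with their polar decompositions. -/
theorem exists_profile (ν : ℂ) {σ : ℝ} (hσ : σ = 1 ∨ σ = -1) :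
    ∃ t₀ > (0 : ℝ), ∃ (u u' : ℝ → ℝ → ℂ) (r : ℝ → ℂ) (c c' : ℝ → ℝ),
    Continuous (Function.uncurry u) ∧ Continuous (Function.uncurry u') ∧ Continuous r ∧
    (∀ θ, u 0 θ = (c θ : ℂ)) ∧ (∀ θ, u' 0 θ = (c' θ : ℂ)) ∧ r 0 = 3 / 4 ∧
    (∀ θ, 2 * c θ ^ 2 = 1 - σ * Real.cos (2 * θ)) ∧
    (∀ θ, 2 * c' θ ^ 2 = 1 + σ * Real.cos (2 * θ)) ∧
    (∀ θ, 2 * (c θ * c' θ) = σ * Real.sin (2 * θ)) ∧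
    ∀ t, |t| ≤ t₀ → (∀ θ, HasDerivAt (u t) (u' t θ) θ) ∧
      (∀ θ, HasDerivAt (u' t) (profileRHS ν (r t) t (u t θ)) θ) ∧
      (∀ θ, u t (-θ) = -σ * u t θ) ∧ (∀ θ, u t (θ + Real.pi) = -u t θ) ∧
      (∃ θ₁ θ₂, u t θ₁ = 0 ∧ u t θ₂ ≠ 0) ∧
      ∃ S ψ : ℝ → ℝ, ContDiff ℝ 2 S ∧ ContDiff ℝ 2 ψ ∧
        (∀ θ, u t θ = (S θ : ℂ) * Complex.exp (Complex.I * (ψ θ : ℂ))) ∧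
        (∀ θ, S (-θ) = -σ * S θ) ∧ (∀ θ, S (θ + Real.pi) = -S θ) ∧
        (∀ θ, ψ (-θ) = ψ θ) ∧ Function.Periodic ψ Real.pi := by
  obtain ⟨t₀, ht₀, u, u', r, hu, hu', hr, hu0, hu'0, hr0, h⟩ := exists_even_profile ν
  -- The shift is `0` for `σ = -1` (even profile) and `π / 2` for `σ = 1` (odd profile).
  obtain ⟨s, hs1, hs2, hs3⟩ : ∃ s : ℝ, Real.cos (2 * s) = -σ ∧ Real.sin (2 * s) = 0 ∧
      ((σ = -1 ∧ s = 0) ∨ (σ = 1 ∧ s = Real.pi / 2)) := by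
    rcases hσ with rfl | rfl
    · exact ⟨Real.pi / 2, by rw [mul_div_cancel₀ _ two_ne_zero]; simp,
        by rw [mul_div_cancel₀ _ two_ne_zero]; simp, Or.inr ⟨rfl, rfl⟩⟩
    · exact ⟨0, by simp, by simp, Or.inl ⟨rfl, rfl⟩⟩
  have hc2 : ∀ θ, Real.cos (2 * (θ + s)) = -σ * Real.cos (2 * θ) := fun θ => by
    rw [mul_add, Real.cos_add, hs1, hs2]; ring
  have hs2' : ∀ θ, Real.sin (2 * (θ + s)) = -σ * Real.sin (2 * θ) := fun θ => by
    rw [mul_add, Real.sin_add, hs1, hs2]; ring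
  have hshift : Continuous fun p : ℝ × ℝ => (p.1, p.2 + s) := by fun_prop
  have hper : ∀ {f : ℝ → ℝ}, (∀ θ, f (-θ) = f θ) → Function.Periodic f Real.pi →
      ∀ θ, f (-θ + s) = f (θ + s) := by
    intro f hf hp θ
    rcases hs3 with ⟨-, rfl⟩ | ⟨-, rfl⟩
    · simp [hf]
    · rw [← hf, ← hp]; congr 1; ring
  have hcos : ∀ θ, Real.cos (-θ + s) = -σ * Real.cos (θ + s) := by
    intro θ
    rcases hs3 with ⟨rfl, rfl⟩ | ⟨rfl, rfl⟩
    · simp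
    · rw [Real.cos_add_pi_div_two, Real.cos_add_pi_div_two, Real.sin_neg]; ring
  refine ⟨t₀, ht₀, fun t θ => u t (θ + s), fun t θ => u' t (θ + s), r,
    fun θ => Real.cos (θ + s), fun θ => -Real.sin (θ + s), hu.comp hshift, hu'.comp hshift, hr,
    fun θ => hu0 _, fun θ => by simp [hu'0], hr0, fun θ => ?_, fun θ => ?_, fun θ => ?_,
    fun t ht => ?_⟩
  · rw [Real.cos_sq, hc2]; ring
  · rw [neg_sq, Real.sin_sq, Real.cos_sq, hc2]; ring
  · have := hs2' θ
    rw [Real.sin_two_mul] at this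
    linarith
  · obtain ⟨h1, h2, h3, h4⟩ := h t ht
    obtain ⟨ρ, ψ, hρ, hψ, hρ0, huρ, hρe, hψe, hρp, hψp⟩ :=
      exists_polar h1 h3 (contDiff_profile h1 h2) h4
    have hsh : ContDiff ℝ 2 fun θ : ℝ => θ + s := contDiff_id.add contDiff_const
    refine ⟨fun θ => (h1 _).comp_add_const θ s, fun θ => (h2 _).comp_add_const θ s,
      fun θ => ?_, fun θ => ?_, ⟨Real.pi / 2 - s, -s, ?_, ?_⟩,
      fun θ => Real.cos (θ + s) * ρ (θ + s), fun θ => ψ (θ + s),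
      (Real.contDiff_cos.comp hsh).mul (hρ.comp hsh), hψ.comp hsh, fun θ => huρ _, fun θ => ?_,
      fun θ => ?_, hper hψe hψp, fun θ => ?_⟩
    · beta_reduce
      rw [huρ, huρ, hper hρe hρp, hper hψe hψp, hcos]; push_cast; ring
    · beta_reduce
      rw [add_right_comm]; exact h3.anti _
    · beta_reduce
      rw [sub_add_cancel]; exact h3.eq_zero_of_cos_eq_zero Real.cos_pi_div_two
    · beta_reduce
      rw [neg_add_cancel, huρ, Real.cos_zero, one_mul]
      exact mul_ne_zero (by exact_mod_cast hρ0 0) (Complex.exp_ne_zero _)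
    · beta_reduce
      rw [hcos, hper hρe hρp]; ring
    · beta_reduce
      rw [add_right_comm, Real.cos_add_pi, hρp]; ring
    · beta_reduce
      rw [add_right_comm, hψp]

/-! ### The stationary equation and its quadratic invariants. -/

/-- The right-hand side `-p z + δ ν |z|² z` of the stationary equation solved for the second
derivative. -/
def statRHS (p ν : ℂ) (δ : ℝ) (z : ℂ) : ℂ := -p * z + δ * ν * cub z

/-- If `(1 + i α) p = x + i y`, the real and imaginary parts of `p` are known. -/
theorem re_im_of_one_add_mul {α x y : ℝ} {p : ℂ}
    (h : (1 + Complex.I * α) * p = x + Complex.I * y) :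
    (1 + α ^ 2) * p.re = x + α * y ∧ (1 + α ^ 2) * p.im = y - α * x := by
  have h1 := congrArg Complex.re h
  have h2 := congrArg Complex.im h
  simp at h1 h2
  constructor
  · linear_combination h1 + α * h2
  · linear_combination h2 - α * h1

theorem hasDerivAt_re {f : ℝ → ℂ} {f' : ℂ} {x : ℝ} (h : HasDerivAt f f' x) :
    HasDerivAt (fun y => (f y).re) f'.re x :=
  Complex.reCLM.hasFDerivAt.comp_hasDerivAt x h

theorem hasDerivAt_im {f : ℝ → ℂ} {f' : ℂ} {x : ℝ} (h : HasDerivAt f f' x) :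
    HasDerivAt (fun y => (f y).im) f'.im x :=
  Complex.imCLM.hasFDerivAt.comp_hasDerivAt x h

theorem cub_re (z : ℂ) : (cub z).re = Complex.normSq z * z.re := by
  simp only [cub, Complex.mul_re, Complex.mul_im, Complex.conj_re, Complex.conj_im,
    Complex.normSq_apply]
  ring

theorem cub_im (z : ℂ) : (cub z).im = Complex.normSq z * z.im := by
  simp only [cub, Complex.mul_re, Complex.mul_im, Complex.conj_re, Complex.conj_im,
    Complex.normSq_apply]
  ring

/-! The quadratic invariants `|B|²`, `Re (B̄ B')`, `|B'|²`, `Im (B̄ B')`. -/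

section invariants

variable {p ν : ℂ} {δ : ℝ} {B B' : ℝ → ℂ} {x : ℝ} (hB : HasDerivAt B (B' x) x)

include hB

theorem hasDerivAt_normSq :
    HasDerivAt (fun y => Complex.normSq (B y)) (2 * (conj (B x) * B' x).re) x := by
  have hr := hasDerivAt_re hB
  have hi := hasDerivAt_im hB
  have h := (hr.fun_mul hr).fun_add (hi.fun_mul hi)
  simp only [Complex.normSq_apply]
  refine h.congr_deriv ?_
  simp; ring

variable (hB' : HasDerivAt B' (statRHS p ν δ (B x)) x)

include hB'

theorem hasDerivAt_re_conj_mul :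
    HasDerivAt (fun y => (conj (B y) * B' y).re)
      (Complex.normSq (B' x) - p.re * Complex.normSq (B x)
        + δ * ν.re * Complex.normSq (B x) ^ 2) x := by
  have h := ((hasDerivAt_re hB).fun_mul (hasDerivAt_re hB')).fun_add
    ((hasDerivAt_im hB).fun_mul (hasDerivAt_im hB'))
  have he : (fun y => (conj (B y) * B' y).re) =
      fun y => (B y).re * (B' y).re + (B y).im * (B' y).im := by
    ext y; simp
  rw [he]
  refine h.congr_deriv ?_
  simp [statRHS, cub_re, cub_im, Complex.normSq_apply]; ring

theorem hasDerivAt_im_conj_mul :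
    HasDerivAt (fun y => (conj (B y) * B' y).im)
      (-p.im * Complex.normSq (B x) + δ * ν.im * Complex.normSq (B x) ^ 2) x := by
  have h := ((hasDerivAt_re hB).fun_mul (hasDerivAt_im hB')).fun_sub
    ((hasDerivAt_im hB).fun_mul (hasDerivAt_re hB'))
  have he : (fun y => (conj (B y) * B' y).im) =
      fun y => (B y).re * (B' y).im - (B y).im * (B' y).re := by
    ext y; simp; ring
  rw [he]
  refine h.congr_deriv ?_
  simp [statRHS, cub_re, cub_im, Complex.normSq_apply]; ring

omit hB in
theorem hasDerivAt_normSq_deriv :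
    HasDerivAt (fun y => Complex.normSq (B' y))
      (2 * (-p.re * (conj (B x) * B' x).re - p.im * (conj (B x) * B' x).im
        + δ * ν.re * Complex.normSq (B x) * (conj (B x) * B' x).re
        + δ * ν.im * Complex.normSq (B x) * (conj (B x) * B' x).im)) x := by
  refine (hasDerivAt_normSq (B' := fun _ => statRHS p ν δ (B x)) hB').congr_deriv ?_
  simp [statRHS, cub_re, cub_im, Complex.normSq_apply]; ring

end invariants

/-! ### From the invariants to the 4-D system. -/

/-- The rescaled point of the phase space with invariants `n = |B|²`, `j = Re (B̄ B')`,
`K = |B'|²`, `m = Im (B̄ B')`. -/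
def orbitPoint (μ α β lam ω ε D η n j K m : ℝ) : Fin 4 → ℝ :=
  ![lam * (2 * D * (K - (μ + α * ω) / (1 + α ^ 2) * n
        + ε * D * ((1 + α * β) / (1 + α ^ 2)) * n ^ 2) / dC α β)
      + eTilde μ α β lam ω * ((D * n - η) / dC α β)
      + ε * dC α β * ((D * n - η) / dC α β) ^ 2,
    lam / aC α β * ((1 + α ^ 2) * D * m + lam * (2 * D * j / dC α β)),
    (D * n - η) / dC α β,
    2 * D * j / dC α β]

section algebra

variable {μ α β lam ω ε D η : ℝ} (hαβ : α ≠ β)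

include hαβ

theorem dC_ne_zero : dC α β ≠ 0 := one_div_ne_zero (sub_ne_zero.2 hαβ.symm)

theorem aC_ne_zero : aC α β ≠ 0 := by
  have : β - α ≠ 0 := sub_ne_zero.2 hαβ.symm
  have : (0 : ℝ) < 1 + α ^ 2 := by positivity
  unfold aC; positivity

theorem lam_ne_zero (hlam : IsLambda α β lam) : lam ≠ 0 := by
  rintro rfl
  have := aC_ne_zero hαβ
  have := dC_ne_zero hαβ
  unfold IsLambda at hlam
  simp_all

/-- This puts the quadratic equation for `lam` in terms of `Re ν = (1 + αβ) / (1 + α²)`, the form in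
which it meets the derivative of `M̃`. -/
theorem IsLambda.sq_eq (hlam : IsLambda α β lam) :
    lam ^ 2 = aC α β * dC α β * (6 * lam * ((1 + α * β) / (1 + α ^ 2)) + 2) := by
  have hb : β - α ≠ 0 := sub_ne_zero.2 hαβ.symm
  have hA : (1 + α ^ 2 : ℝ) ≠ 0 := by positivity
  unfold IsLambda at hlam
  have : cC α β = -6 * aC α β * dC α β * ((1 + α * β) / (1 + α ^ 2)) := by
    unfold cC aC dC; field_simp; ring
  rw [this] at hlam
  linear_combination hlam

theorem one_add_sq_eq : 1 + α ^ 2 = 4 * ((β - α) / (1 + α ^ 2)) * aC α β := by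
  have hb : β - α ≠ 0 := sub_ne_zero.2 hαβ.symm
  have hA : (1 + α ^ 2 : ℝ) ≠ 0 := by positivity
  unfold aC; field_simp

theorem eTilde_eq : eTilde μ α β lam ω = 4 * lam * ((μ + α * ω) / (1 + α ^ 2))
    - 6 * lam * ((1 + α * β) / (1 + α ^ 2)) * eC μ α β ω := by
  have hb : β - α ≠ 0 := sub_ne_zero.2 hαβ.symm
  have hA : (1 + α ^ 2 : ℝ) ≠ 0 := by positivity
  unfold eTilde bC aC eC; field_simp; ring

theorem sub_div_eq : (ω - α * μ) / (1 + α ^ 2) = eC μ α β ω * ((β - α) / (1 + α ^ 2)) := by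
  have hb : β - α ≠ 0 := sub_ne_zero.2 hαβ.symm
  unfold eC; field_simp

/-- The orbit built from a solution of the stationary equation solves the rescaled system. -/
theorem hasDerivAt_orbitPoint (hlam : IsLambda α β lam) (he : eC μ α β ω = ε * η)
    {p ν : ℂ} (hp : (1 + Complex.I * α) * p = μ + Complex.I * ω)
    (hν : (1 + Complex.I * α) * ν = 1 + Complex.I * β) {B B' : ℝ → ℂ} {x : ℝ}
    (hB : HasDerivAt B (B' x) x) (hB' : HasDerivAt B' (statRHS p ν (ε * D) (B x)) x) :
    HasDerivAt (fun y => orbitPoint μ α β lam ω ε D η (Complex.normSq (B y))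
        (conj (B y) * B' y).re (Complex.normSq (B' y)) (conj (B y) * B' y).im)
      ((linMatrix μ α β lam ω (-(lam * eTilde μ α β lam ω / aC α β))).mulVec
        (orbitPoint μ α β lam ω ε D η (Complex.normSq (B x))
          (conj (B x) * B' x).re (Complex.normSq (B' x)) (conj (B x) * B' x).im)
        + ε • quadPart α β lam (lam / aC α β * η)
          (orbitPoint μ α β lam ω ε D η (Complex.normSq (B x))
            (conj (B x) * B' x).re (Complex.normSq (B' x)) (conj (B x) * B' x).im)) x := by
  have hn := hasDerivAt_normSq hB
  have hj := hasDerivAt_re_conj_mul hB hB'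
  have hK := hasDerivAt_normSq_deriv (B := B) hB'
  have hm := hasDerivAt_im_conj_mul hB hB'
  have hA : (1 + α ^ 2 : ℝ) ≠ 0 := by positivity
  have hpre : p.re = (μ + α * ω) / (1 + α ^ 2) := by
    rw [eq_div_iff hA, mul_comm]; exact (re_im_of_one_add_mul hp).1
  have hpim : p.im = ε * η * ((β - α) / (1 + α ^ 2)) := by
    rw [← he, ← sub_div_eq hαβ, eq_div_iff hA, mul_comm]; exact (re_im_of_one_add_mul hp).2
  have hν' : (1 + Complex.I * α) * ν = (1 : ℝ) + Complex.I * β := by rw [hν]; simp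
  have hνre : ν.re = (1 + α * β) / (1 + α ^ 2) := by
    rw [eq_div_iff hA, mul_comm]; exact (re_im_of_one_add_mul hν').1
  have hνim : ν.im = (β - α) / (1 + α ^ 2) := by
    rw [eq_div_iff hA, mul_comm]
    simpa using (re_im_of_one_add_mul hν').2
  rw [hpre, hνre] at hj
  rw [hpim, hνim] at hm
  rw [hpre, hpim, hνre, hνim] at hK
  have hsq := hlam.sq_eq hαβ
  have hae := one_add_sq_eq hαβ
  have het := eTilde_eq (μ := μ) (lam := lam) (ω := ω) hαβ
  have ha := aC_ne_zero hαβ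
  have hd := dC_ne_zero hαβ
  have hl := lam_ne_zero hαβ hlam
  rw [he] at het
  have hd2 : (1 + α ^ 2) * ((β - α) / (1 + α ^ 2)) * dC α β = 1 := by
    have hb : β - α ≠ 0 := sub_ne_zero.2 hαβ.symm
    unfold dC; field_simp
  generalize hn0 : Complex.normSq (B x) = n at *
  generalize hj0 : (conj (B x) * B' x).re = j at *
  generalize hK0 : Complex.normSq (B' x) = K at *
  generalize hm0 : (conj (B x) * B' x).im = m at *
  unfold orbitPoint linMatrix quadPart
  generalize (μ + α * ω) / (1 + α ^ 2) = P at *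
  generalize (1 + α * β) / (1 + α ^ 2) = ν₁ at *
  generalize (β - α) / (1 + α ^ 2) = ν₂ at *
  generalize eTilde μ α β lam ω = et at *
  generalize aC α β = a at *
  generalize dC α β = d at *
  have hA' : lam / a * (1 + α ^ 2) = 4 * lam * ν₂ := by rw [hae]; field_simp
  -- The only use of the equation for `lam`: it matches the terms in `P Q` of `M̃'` with those of `Ñ
  -- P`.
  have hq : lam / a * lam / d = 6 * lam * ν₁ + 2 := by
    field_simp; linear_combination hsq
  have hdd : d * d⁻¹ = 1 := mul_inv_cancel₀ hd
  rw [hasDerivAt_pi]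
  intro i
  fin_cases i
  · refine (((((hK.fun_sub (hn.const_mul P)).fun_add ((hn.fun_pow 2).const_mul
      (ε * D * ν₁))).const_mul (2 * D)).div_const d).const_mul lam |>.fun_add
      ((((hn.const_mul D).sub_const η).div_const d).const_mul et) |>.fun_add
      (((((hn.const_mul D).sub_const η).div_const d).fun_pow 2).const_mul (ε * d))).congr_deriv ?_
    simp [hn0, het]
    linear_combination -(ε * D * m * (D * n - η) / d) * hA' - ε * 2 * D * j * (D * n - η) / d * hq
      + 4 * ε * D * j * (D * n - η) * d⁻¹ * hdd
  · refine (((hm.const_mul ((1 + α ^ 2) * D)).fun_add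
      (((hj.const_mul (2 * D)).div_const d).const_mul lam)).const_mul (lam / a)).congr_deriv ?_
    simp
    linear_combination (lam / a * D * ε * n * (D * n - η)) * d⁻¹ * hd2
      - lam / a * ε * (D * n - η) * (D * n - η) * d⁻¹ * hdd
      - lam / a * ε * (D * n - η) * D * n * (1 + α ^ 2) * ν₂ * hdd
  · refine (((hn.const_mul D).sub_const η).div_const d).congr_deriv ?_
    simp
    ring
  · refine ((hj.const_mul (2 * D)).div_const d).congr_deriv ?_
    simp
    field_simp
    ring

/-- In the invariants, `e + dP` is `ε D n`, `G` is `ε D m` and `Q` is a multiple of `j`; the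
condition then collapses to a multiple of `h`. -/
theorem consistent_smul_orbitPoint (hlam : IsLambda α β lam) (he : eC μ α β ω = ε * η)
    {n j K m : ℝ} (h : n * K = j ^ 2 + m ^ 2) :
    Consistent μ α β lam ω (ε • orbitPoint μ α β lam ω ε D η n j K m) := by
  have hl := lam_ne_zero hαβ hlam
  have ha := aC_ne_zero hαβ
  have hd := dC_ne_zero hαβ
  have hA : (1 + α ^ 2 : ℝ) ≠ 0 := by positivity
  unfold Consistent bigM
  rw [he]
  have h1 : dC α β * (ε • orbitPoint μ α β lam ω ε D η n j K m) 2 + ε * η = ε * D * n := by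
    simp [orbitPoint]; field_simp; ring
  have h2 : (ε • orbitPoint μ α β lam ω ε D η n j K m) 0
      - dC α β * (ε • orbitPoint μ α β lam ω ε D η n j K m) 2 ^ 2
      - eTilde μ α β lam ω * (ε • orbitPoint μ α β lam ω ε D η n j K m) 2 =
      ε * lam * (2 * D * (K - (μ + α * ω) / (1 + α ^ 2) * n
        + ε * D * ((1 + α * β) / (1 + α ^ 2)) * n ^ 2) / dC α β) := by
    simp [orbitPoint]; ring
  have h3 : aC α β / lam * (ε • orbitPoint μ α β lam ω ε D η n j K m) 1
      - lam * (ε • orbitPoint μ α β lam ω ε D η n j K m) 3 = ε * ((1 + α ^ 2) * D * m) := by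
    simp [orbitPoint]; field_simp; ring
  have h4 : (ε • orbitPoint μ α β lam ω ε D η n j K m) 3 = ε * (2 * D * j / dC α β) := by
    simp [orbitPoint]
  rw [h1, h2, h3, h4]
  field_simp
  linear_combination 4 * (1 + α ^ 2) * ε ^ 2 * D ^ 2 * h

end algebra

/-- The 4-D vector field at `ε X` is `ε` times the rescaled one at `X`. -/
theorem field4_smul (μ α β lam ω ε k₁ k₂ : ℝ) (X : Fin 4 → ℝ) :
    field4 μ α β lam ω (k₁ + ε * k₂) (ε • X) =
      ε • ((linMatrix μ α β lam ω k₁).mulVec X + ε • quadPart α β lam k₂ X) := by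
  ext i
  fin_cases i <;>
    simp [field4, linMatrix, quadPart, dotProduct, Fin.sum_univ_four] <;> ring

/-- The value of `k₁` makes the second row a multiple of the fourth. The kernel is then `Q = 0`, `M̃
= ẽ P`, with `Ñ` and `P` free. -/
theorem finrank_ker_linMatrix {μ α β lam : ℝ} (ω : ℝ) (hlam : lam ≠ 0) :
    Module.finrank ℝ (LinearMap.ker (Matrix.toLin'
      (linMatrix μ α β lam ω (-(lam * eTilde μ α β lam ω / aC α β))))) = 2 := by
  set f : (Fin 2 → ℝ) →ₗ[ℝ] (Fin 4 → ℝ) :=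
    Matrix.toLin' !![0, eTilde μ α β lam ω; 1, 0; 0, 1; 0, 0] with hf
  have hinj : Function.Injective f := by
    rw [← LinearMap.ker_eq_bot, LinearMap.ker_eq_bot']
    intro v hv
    have h1 := congrFun hv 1
    have h2 := congrFun hv 2
    simp [hf, Matrix.toLin'_apply, Matrix.mulVec, dotProduct, Fin.sum_univ_two] at h1 h2
    ext i; fin_cases i <;> simp [h1, h2]
  have hker : LinearMap.ker (Matrix.toLin'
      (linMatrix μ α β lam ω (-(lam * eTilde μ α β lam ω / aC α β)))) = LinearMap.range f := by
    ext v
    rw [LinearMap.mem_ker, LinearMap.mem_range]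
    constructor
    · intro hv
      have h2 := congrFun hv 2
      have h3 := congrFun hv 3
      simp [Matrix.toLin'_apply, Matrix.mulVec, dotProduct, Fin.sum_univ_four, linMatrix]
        at h2 h3
      have h3' : v 0 = eTilde μ α β lam ω * v 2 := by
        field_simp at h3
        linarith
      refine ⟨![v 1, v 2], ?_⟩
      ext i
      fin_cases i <;>
        simp [hf, Matrix.toLin'_apply, Matrix.mulVec, dotProduct, Fin.sum_univ_two, h3', h2]
    · rintro ⟨w, rfl⟩
      ext i
      fin_cases i <;>
        simp [hf, Matrix.toLin'_apply, Matrix.mulVec, dotProduct, Fin.sum_univ_two,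
          Fin.sum_univ_four, linMatrix] <;> ring
  rw [hker, LinearMap.finrank_range_of_inj hinj]
  simp

/-! ### Back to the Ginzburg-Landau equation and its amplitude-phase form. -/

section stationary

variable {μ α β ω δ : ℝ} {p ν : ℂ} {B B' : ℝ → ℂ}
  (hp : (1 + Complex.I * α) * p = μ + Complex.I * ω)
  (hν : (1 + Complex.I * α) * ν = 1 + Complex.I * β)
  (hB : ∀ x, HasDerivAt B (B' x) x)
  (hB' : ∀ x, HasDerivAt B' (statRHS p ν δ (B x)) x)

theorem contDiff_two_of_statRHS (hB : ∀ x, HasDerivAt B (B' x) x)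
    (hB' : ∀ x, HasDerivAt B' (statRHS p ν δ (B x)) x) : ContDiff ℝ 2 B := by
  have hc : Continuous B := continuous_iff_continuousAt.2 fun θ => (hB θ).continuousAt
  have h0 : ContDiff ℝ (0 : ℕ) fun x => statRHS p ν δ (B x) := by
    rw [Nat.cast_zero, contDiff_zero]
    exact (hc.const_mul _).add ((continuous_cub.comp hc).const_mul _)
  have h1 : ContDiff ℝ (1 : ℕ) B' := by
    have := contDiff_succ_of_hasDerivAt hB' h0
    exact_mod_cast this
  have h2 := contDiff_succ_of_hasDerivAt hB h1
  exact_mod_cast h2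

theorem iteratedDeriv_two_eq {f f' : ℝ → ℂ} {f'' : ℂ} {x : ℝ} (h : ∀ x, HasDerivAt f (f' x) x)
    (h' : HasDerivAt f' f'' x) : iteratedDeriv 2 f x = f'' := by
  rw [iteratedDeriv_succ, iteratedDeriv_one, show deriv f = f' from funext fun x => (h x).deriv,
    h'.deriv]

/-- The equation for `S e^{iψ}` is divided by the unimodular factor only, never by `S`, so the real
and imaginary parts hold at the zeros of `S` too. -/
theorem polar_equations {S S₁ S₂ ψ ψ₁ ψ₂ : ℝ → ℝ}
    (hS1 : ∀ x, HasDerivAt S (S₁ x) x) (hS2 : ∀ x, HasDerivAt S₁ (S₂ x) x)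
    (hψ1 : ∀ x, HasDerivAt ψ (ψ₁ x) x) (hψ2 : ∀ x, HasDerivAt ψ₁ (ψ₂ x) x)
    (hB : ∀ x, HasDerivAt B (B' x) x) (hB' : ∀ x, HasDerivAt B' (statRHS p ν δ (B x)) x)
    (hBS : ∀ x, B x = (S x : ℂ) * Complex.exp (Complex.I * (ψ x : ℂ))) (x : ℝ) :
    S₂ x - S x * ψ₁ x ^ 2 = -p.re * S x + δ * ν.re * S x ^ 3 ∧
    2 * S₁ x * ψ₁ x + S x * ψ₂ x =
      -p.im * S x + δ * ν.im * S x ^ 3 ∧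
    (conj (B x) * B' x).im = ψ₁ x * S x ^ 2 := by
  have hE : ∀ x, HasDerivAt (fun x => Complex.exp (Complex.I * (ψ x : ℂ)))
      (Complex.exp (Complex.I * (ψ x : ℂ)) * (Complex.I * (ψ₁ x : ℂ))) x := fun x => by
    have h : HasDerivAt (fun y => Complex.I * (ψ y : ℂ)) (Complex.I * (ψ₁ x : ℂ)) x :=
      (hψ1 x).ofReal_comp.const_mul Complex.I
    exact h.cexp
  have hconj : ∀ x, conj (Complex.exp (Complex.I * (ψ x : ℂ)))
      * Complex.exp (Complex.I * (ψ x : ℂ)) = 1 := fun x => by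
    rw [← Complex.exp_conj, ← Complex.exp_add]; simp
  have hne : Complex.exp (Complex.I * (ψ x : ℂ)) ≠ 0 := Complex.exp_ne_zero _
  obtain ⟨E, hEdef⟩ : ∃ E : ℝ → ℂ, ∀ x, Complex.exp (Complex.I * (ψ x : ℂ)) = E x :=
    ⟨fun x => Complex.exp (Complex.I * (ψ x : ℂ)), fun _ => rfl⟩
  simp only [hEdef] at hE hconj hBS hne
  have hB1 : ∀ x, B' x = ((S₁ x : ℂ) + Complex.I * (S x * ψ₁ x)) * E x := fun x => by
    have h := ((hS1 x).ofReal_comp.fun_mul (hE x)).congr_of_eventuallyEq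
      (Filter.Eventually.of_forall hBS)
    rw [(hB x).unique h]; ring
  have hB2 : ((S₂ x - S x * ψ₁ x ^ 2 : ℝ) : ℂ)
      + Complex.I * ((2 * S₁ x * ψ₁ x + S x * ψ₂ x : ℝ) : ℂ)
      = -p * S x + δ * ν * (S x) ^ 3 := by
    have h := (((hS2 x).ofReal_comp.fun_add (((hS1 x).ofReal_comp.fun_mul
      (hψ2 x).ofReal_comp).const_mul Complex.I)).fun_mul (hE x)).congr_of_eventuallyEq
      (Filter.Eventually.of_forall hB1)
    have h2 := (hB' x).unique h
    have hcub : cub (B x) = (S x : ℂ) ^ 3 * E x := by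
      rw [hBS, cub, map_mul, Complex.conj_ofReal]
      linear_combination (S x : ℂ) ^ 3 * E x * hconj x
    rw [statRHS, hcub, hBS] at h2
    refine mul_right_cancel₀ hne ?_
    push_cast
    linear_combination -h2 - S x * ψ₁ x ^ 2 * E x * Complex.I_sq
  have hre : S₂ x - S x * ψ₁ x ^ 2 =
      -p.re * S x + δ * ν.re * S x ^ 3 := by
    have := congrArg Complex.re hB2
    simpa [← Complex.ofReal_pow] using this
  have him : 2 * S₁ x * ψ₁ x + S x * ψ₂ x =
      -p.im * S x + δ * ν.im * S x ^ 3 := by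
    have := congrArg Complex.im hB2
    simpa [← Complex.ofReal_pow] using this
  refine ⟨hre, him, ?_⟩
  · have : conj (B x) * B' x = ((S x * S₁ x : ℝ) : ℂ)
        + Complex.I * ((ψ₁ x * S x ^ 2 : ℝ) : ℂ) := by
      rw [hB1, hBS, map_mul, Complex.conj_ofReal]
      push_cast
      linear_combination (S x : ℂ) * (S₁ x + Complex.I * (S x * ψ₁ x)) * hconj x
    rw [this]
    simp [-Complex.ofReal_pow]

include hp hν hB hB'

theorem solvesCGL_of_statRHS (hδ : 0 < δ) :
    SolvesCGL μ α β fun x t =>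
      ((√δ : ℝ) : ℂ) * B x * Complex.exp (-(Complex.I * (ω : ℂ) * (t : ℂ))) := by
  have hE : ∀ t : ℝ, HasDerivAt (fun s : ℝ => Complex.exp (-(Complex.I * (ω : ℂ) * (s : ℂ))))
      (Complex.exp (-(Complex.I * (ω : ℂ) * (t : ℂ))) * -(Complex.I * (ω : ℂ))) t := by
    intro t
    have h1 : HasDerivAt (fun s : ℝ => -(Complex.I * (ω : ℂ) * (s : ℂ)))
        (-(Complex.I * (ω : ℂ))) t := by
      simpa using ((hasDerivAt_id t).ofReal_comp.const_mul (Complex.I * (ω : ℂ))).fun_neg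
    exact h1.cexp
  have hs : ((√δ : ℝ) : ℂ) * ((√δ : ℝ) : ℂ) = δ := by
    rw [← Complex.ofReal_mul, Real.mul_self_sqrt hδ.le]
  refine ⟨fun t => ?_, fun x => ?_, fun x t => ?_⟩
  · exact (contDiff_const.mul (contDiff_two_of_statRHS hB hB')).mul contDiff_const
  · refine contDiff_const.mul (Complex.contDiff_exp.comp (𝕜 := ℝ) ?_)
    exact (contDiff_const.mul Complex.ofRealCLM.contDiff).neg
  · have h1 : ∀ y, HasDerivAt (fun y => ((√δ : ℝ) : ℂ) * B y
        * Complex.exp (-(Complex.I * (ω : ℂ) * (t : ℂ))))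
        (((√δ : ℝ) : ℂ) * B' y * Complex.exp (-(Complex.I * (ω : ℂ) * (t : ℂ)))) y :=
      fun y => ((hB y).const_mul _).mul_const _
    have h2 := ((hB' x).const_mul ((√δ : ℝ) : ℂ)).mul_const
      (Complex.exp (-(Complex.I * (ω : ℂ) * (t : ℂ))))
    rw [iteratedDeriv_two_eq h1 h2, ((hE t).const_mul _).deriv]
    have hnorm : ((‖((√δ : ℝ) : ℂ) * B x
        * Complex.exp (-(Complex.I * (ω : ℂ) * (t : ℂ)))‖ : ℝ) : ℂ) ^ 2 =
        δ * (B x * conj (B x)) := by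
      have he : ‖Complex.exp (-(Complex.I * (ω : ℂ) * (t : ℂ)))‖ = 1 := by
        rw [Complex.norm_exp]; simp
      rw [norm_mul, he, mul_one, norm_mul, Complex.norm_real, Real.norm_of_nonneg (by positivity),
        Complex.mul_conj, Complex.normSq_eq_norm_sq, ← hs]
      push_cast; ring
    rw [hnorm]
    simp only [statRHS, cub]
    linear_combination (((√δ : ℝ) : ℂ) * B x
        * Complex.exp (-(Complex.I * (ω : ℂ) * (t : ℂ)))) * hp
      - (((√δ : ℝ) : ℂ) * B x * Complex.exp (-(Complex.I * (ω : ℂ) * (t : ℂ)))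
        * δ * (B x * conj (B x))) * hν

/-- The imaginary part times `S` is the equation for `G_x`, and the real part times `S³` is the
equation for `G²`; multiplying keeps both valid at the zeros of `S`. -/
theorem solvesStationary_of_polar (hδ : 0 < δ) {S ψ : ℝ → ℝ} (hS : ContDiff ℝ 2 S)
    (hψ : ContDiff ℝ 2 ψ)
    (hBS : ∀ x, B x = (S x : ℂ) * Complex.exp (Complex.I * (ψ x : ℂ))) :
    SolvesStationary μ α β ω (fun x => √δ * S x) ψ ∧
      ∀ x, angMom (fun x => √δ * S x) ψ x = δ * (conj (B x) * B' x).im := by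
  have hS1 : ∀ x, HasDerivAt S (deriv S x) x := fun x =>
    (hS.differentiable (by simp) x).hasDerivAt
  have hψ1 : ∀ x, HasDerivAt ψ (deriv ψ x) x := fun x =>
    (hψ.differentiable (by simp) x).hasDerivAt
  have hdS : ContDiff ℝ 1 (deriv S) :=
    ((contDiff_succ_iff_deriv (n := 1)).1 (by norm_num; exact hS)).2.2
  have hdψ : ContDiff ℝ 1 (deriv ψ) :=
    ((contDiff_succ_iff_deriv (n := 1)).1 (by norm_num; exact hψ)).2.2
  have hS2 : ∀ x, HasDerivAt (deriv S) (deriv (deriv S) x) x := fun x =>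
    (hdS.differentiable (by simp) x).hasDerivAt
  have hψ2 : ∀ x, HasDerivAt (deriv ψ) (deriv (deriv ψ) x) x := fun x =>
    (hdψ.differentiable (by simp) x).hasDerivAt
  have hs : √δ ^ 2 = δ := Real.sq_sqrt hδ.le
  obtain ⟨hp1, hp2⟩ := re_im_of_one_add_mul hp
  have hν' : (1 + Complex.I * α) * ν = (1 : ℝ) + Complex.I * β := by rw [hν]; simp
  obtain ⟨hν1, hν2⟩ := re_im_of_one_add_mul hν'
  have hre := fun x => (polar_equations hS1 hS2 hψ1 hψ2 hB hB' hBS x).1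
  have him := fun x => (polar_equations hS1 hS2 hψ1 hψ2 hB hB' hBS x).2.1
  have hang : ∀ x, angMom (fun x => √δ * S x) ψ x = δ * (deriv ψ x * S x ^ 2) := fun x => by
    simp only [angMom, mul_pow, hs]; ring
  refine ⟨⟨contDiff_const.mul hS, hψ, fun x => ?_, fun x => ?_⟩, fun x => ?_⟩
  · rw [show angMom (fun x => √δ * S x) ψ = _ from funext hang,
      (((hψ2 x).fun_mul ((hS1 x).fun_pow 2)).const_mul δ).deriv]
    have h4 : (√δ * S x) ^ 4 = δ ^ 2 * S x ^ 4 := by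
      calc _ = (√δ ^ 2) ^ 2 * S x ^ 4 := by ring
        _ = _ := by rw [hs]
    rw [h4, mul_pow, hs]
    push_cast
    linear_combination δ * S x * (1 + α ^ 2) * him x - δ * S x ^ 2 * hp2 + δ ^ 2 * S x ^ 4 * hν2
  · have h2 : iteratedDeriv 2 (fun x => √δ * S x) x = √δ * deriv (deriv S) x := by
      rw [iteratedDeriv_succ, iteratedDeriv_one,
        show deriv (fun x => √δ * S x) = fun x => √δ * deriv S x from
          funext fun x => ((hS1 x).const_mul _).deriv, ((hS2 x).const_mul _).deriv]
    rw [hang, h2]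
    have h4 : (√δ * S x) ^ 4 = δ ^ 2 * S x ^ 4 := by
      calc _ = (√δ ^ 2) ^ 2 * S x ^ 4 := by ring
        _ = _ := by rw [hs]
    have h6 : (√δ * S x) ^ 6 = δ ^ 3 * S x ^ 6 := by
      calc _ = (√δ ^ 2) ^ 3 * S x ^ 6 := by ring
        _ = _ := by rw [hs]
    have h3 : (√δ * S x) ^ 3 * (√δ * deriv (deriv S) x) =
        δ ^ 2 * S x ^ 3 * deriv (deriv S) x := by
      calc _ = (√δ ^ 2) ^ 2 * S x ^ 3 * deriv (deriv S) x := by ring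
        _ = _ := by rw [hs]
    rw [mul_assoc (1 + α ^ 2) ((√δ * S x) ^ 3), h3, h4, h6]
    linear_combination -(1 + α ^ 2) * δ ^ 2 * S x ^ 3 * hre x + δ ^ 2 * S x ^ 4 * hp1
      - δ ^ 3 * S x ^ 6 * hν1
  · rw [hang, (polar_equations hS1 hS2 hψ1 hψ2 hB hB' hBS x).2.2]

end stationary

/-! ### Orbits in the phase variable, at a fixed parameter. -/

/-- The rescaled orbit of a profile `u` with derivative `u'`, as a function of the phase
`θ = Ω τ / 2`. -/
def orbit (μ α β lam ω ε D η Ω : ℝ) (u u' : ℝ → ℂ) (θ : ℝ) : Fin 4 → ℝ :=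
  orbitPoint μ α β lam ω ε D η (Complex.normSq (u θ)) (Ω / 2 * (conj (u θ) * u' θ).re)
    (Ω ^ 2 / 4 * Complex.normSq (u' θ)) (Ω / 2 * (conj (u θ) * u' θ).im)

theorem continuous_orbitPoint {Y : Type*} [TopologicalSpace Y] (μ α β lam : ℝ)
    {ω ε D η n j K m : Y → ℝ} (hω : Continuous ω) (hε : Continuous ε) (hD : Continuous D)
    (hη : Continuous η) (hn : Continuous n) (hj : Continuous j) (hK : Continuous K)
    (hm : Continuous m) : Continuous fun y =>
      orbitPoint μ α β lam (ω y) (ε y) (D y) (η y) (n y) (j y) (K y) (m y) := by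
  refine continuous_pi fun i => ?_
  fin_cases i <;> simp only [orbitPoint, eTilde, bC, div_eq_mul_inv] <;> simp <;> fun_prop

theorem orbitPoint_neg (μ α β lam ω ε D η n j K m : ℝ) :
    orbitPoint μ α β lam ω ε D η n (-j) K (-m) =
      ![orbitPoint μ α β lam ω ε D η n j K m 0, -orbitPoint μ α β lam ω ε D η n j K m 1,
        orbitPoint μ α β lam ω ε D η n j K m 2, -orbitPoint μ α β lam ω ε D η n j K m 3] := by
  ext i
  fin_cases i <;> simp [orbitPoint] <;> ring

section fixedParameter

variable {μ α β lam ω ε D η Ω σ t : ℝ} {p ν r : ℂ} {u u' : ℝ → ℂ}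

theorem orbit_apply_two (θ : ℝ) : orbit μ α β lam ω ε D η Ω u u' θ 2 =
    (D * Complex.normSq (u θ) - η) / dC α β := rfl

theorem hasDerivAt_comp_phase {f : ℝ → ℂ} {f' : ℂ} {x : ℝ} (h : HasDerivAt f f' (Ω / 2 * x)) :
    HasDerivAt (fun y => f (Ω / 2 * y)) (((Ω / 2 : ℝ) : ℂ) * f') x := by
  have h1 : HasDerivAt (fun y : ℝ => Ω / 2 * y) (Ω / 2) x := by
    simpa using (hasDerivAt_id x).const_mul (Ω / 2)
  have := h.scomp x h1
  rwa [Complex.real_smul] at this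

theorem orbit_eq (x : ℝ) : orbit μ α β lam ω ε D η Ω u u' (Ω / 2 * x) =
    orbitPoint μ α β lam ω ε D η (Complex.normSq (u (Ω / 2 * x)))
      (conj (u (Ω / 2 * x)) * (((Ω / 2 : ℝ) : ℂ) * u' (Ω / 2 * x))).re
      (Complex.normSq (((Ω / 2 : ℝ) : ℂ) * u' (Ω / 2 * x)))
      (conj (u (Ω / 2 * x)) * (((Ω / 2 : ℝ) : ℂ) * u' (Ω / 2 * x))).im := by
  rw [orbit, mul_left_comm, Complex.re_ofReal_mul, Complex.im_ofReal_mul, Complex.normSq_mul,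
    Complex.normSq_ofReal]
  congr 1
  ring

theorem hasDerivAt_scaled_deriv
    (hu' : ∀ θ, HasDerivAt u' (profileRHS ν r t (u θ)) θ)
    (hp : ((Ω ^ 2 / 4 : ℝ) : ℂ) * (1 + t * ν * r) = p) (ht : Ω ^ 2 / 4 * t = ε * D) (x : ℝ) :
    HasDerivAt (fun y => ((Ω / 2 : ℝ) : ℂ) * u' (Ω / 2 * y))
      (statRHS p ν (ε * D) (u (Ω / 2 * x))) x := by
  refine ((hasDerivAt_comp_phase (hu' (Ω / 2 * x))).const_mul _).congr_deriv ?_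
  rw [statRHS, profileRHS, ← hp, ← ht]
  push_cast
  ring

theorem normSq_mul_normSq (z w : ℂ) : Complex.normSq z * Complex.normSq w =
    (conj z * w).re ^ 2 + (conj z * w).im ^ 2 := by
  simp [Complex.normSq_apply]; ring

theorem consistent_orbit (hαβ : α ≠ β) (hlam : IsLambda α β lam) (he : eC μ α β ω = ε * η)
    (θ : ℝ) : Consistent μ α β lam ω (ε • orbit μ α β lam ω ε D η Ω u u' θ) := by
  refine consistent_smul_orbitPoint hαβ hlam he ?_
  linear_combination Ω ^ 2 / 4 * normSq_mul_normSq (u θ) (u' θ)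

theorem deriv_parity (hu : ∀ θ, HasDerivAt u (u' θ) θ)
    (hpar : ∀ θ, u (-θ) = -σ * u θ) (θ : ℝ) : u' (-θ) = σ * u' θ := by
  have h1 : HasDerivAt (fun s => u (-s)) (-u' (-θ)) θ := by
    simpa [Function.comp_def] using (hu (-θ)).scomp θ (hasDerivAt_neg θ)
  rw [show (fun s => u (-s)) = fun s => -(σ : ℂ) * u s from funext hpar] at h1
  have := h1.unique ((hu θ).const_mul _)
  linear_combination -this

theorem orbit_neg (hσ : σ = 1 ∨ σ = -1) (hu : ∀ θ, HasDerivAt u (u' θ) θ)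
    (hpar : ∀ θ, u (-θ) = -σ * u θ) (θ : ℝ) : orbit μ α β lam ω ε D η Ω u u' (-θ) =
      ![orbit μ α β lam ω ε D η Ω u u' θ 0, -orbit μ α β lam ω ε D η Ω u u' θ 1,
        orbit μ α β lam ω ε D η Ω u u' θ 2, -orbit μ α β lam ω ε D η Ω u u' θ 3] := by
  have h2 := deriv_parity hu hpar θ
  simp only [orbit]
  rw [← orbitPoint_neg, hpar, h2]
  rcases hσ with rfl | rfl <;> simp [Complex.normSq_neg] <;> congr 1 <;> ring

/-- Quadratic invariants do not see the sign of `u`, so antiperiodicity of the profile becomes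
periodicity of the orbit with the same `π`. -/
theorem orbit_periodic (hu : ∀ θ, HasDerivAt u (u' θ) θ)
    (hper : ∀ θ, u (θ + Real.pi) = -u θ) :
    Function.Periodic (orbit μ α β lam ω ε D η Ω u u') Real.pi := by
  intro θ
  simp only [orbit]
  rw [hper, deriv_antiperiodic hu hper θ]
  simp [Complex.normSq_neg]

/-- The stationary solution of the Ginzburg-Landau equation attached to a profile. -/
theorem exists_stationary (hαβ : α ≠ β) (hlam : IsLambda α β lam) (he : eC μ α β ω = ε * η)
    (hΩ : 0 < Ω) (hδ : 0 < ε * D)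
    (hp : (1 + Complex.I * α) * (((Ω ^ 2 / 4 : ℝ) : ℂ) * (1 + t * ν * r)) = μ + Complex.I * ω)
    (hν : (1 + Complex.I * α) * ν = 1 + Complex.I * β) (ht : Ω ^ 2 / 4 * t = ε * D)
    (hu : ∀ θ, HasDerivAt u (u' θ) θ) (hu' : ∀ θ, HasDerivAt u' (profileRHS ν r t (u θ)) θ)
    {S ψ : ℝ → ℝ} (hS : ContDiff ℝ 2 S) (hψ : ContDiff ℝ 2 ψ)
    (huS : ∀ θ, u θ = (S θ : ℂ) * Complex.exp (Complex.I * (ψ θ : ℂ)))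
    (hSσ : ∀ θ, S (-θ) = -σ * S θ) (hSp : ∀ θ, S (θ + Real.pi) = -S θ)
    (hψe : ∀ θ, ψ (-θ) = ψ θ) (hψp : Function.Periodic ψ Real.pi) :
    ∃ R φ : ℝ → ℝ, SolvesStationary μ α β ω R φ ∧
      (∀ x, R x ^ 2 = eC μ α β ω
        + dC α β * (ε * orbit μ α β lam ω ε D η Ω u u' (Ω / 2 * x) 2)) ∧
      (∀ x, angMom R φ x = (aC α β / lam * (ε * orbit μ α β lam ω ε D η Ω u u' (Ω / 2 * x) 1)
        - lam * (ε * orbit μ α β lam ω ε D η Ω u u' (Ω / 2 * x) 3)) / (1 + α ^ 2)) ∧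
      (∀ x, R (-x) = -σ * R x) ∧ (∀ x, φ (-x) = φ x) ∧
      (∀ x, R (x + 2 * Real.pi / Ω) = -R x) ∧ Function.Periodic φ (2 * Real.pi / Ω) ∧
      SolvesCGL μ α β (fun x t => (R x : ℂ) *
        Complex.exp (Complex.I * (φ x : ℂ) - Complex.I * (ω : ℂ) * (t : ℂ))) := by
  have hB : ∀ x, HasDerivAt (fun y => u (Ω / 2 * y)) (((Ω / 2 : ℝ) : ℂ) * u' (Ω / 2 * x)) x :=
    fun x => hasDerivAt_comp_phase (hu _)
  have hB' := hasDerivAt_scaled_deriv (ε := ε) (D := D) hu' rfl ht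
  have hlin : ContDiff ℝ 2 fun x : ℝ => Ω / 2 * x := contDiff_const.mul contDiff_id
  have hshift : ∀ x, Ω / 2 * (x + 2 * Real.pi / Ω) = Ω / 2 * x + Real.pi := fun x => by
    field_simp
  have hd := dC_ne_zero hαβ
  have ha := aC_ne_zero hαβ
  have hl := lam_ne_zero hαβ hlam
  have hA : (1 + α ^ 2 : ℝ) ≠ 0 := by positivity
  obtain ⟨h1, h2⟩ := solvesStationary_of_polar hp hν hB hB' hδ (hS.comp hlin) (hψ.comp hlin)
    (fun x => huS _)
  refine ⟨fun x => √(ε * D) * S (Ω / 2 * x), fun x => ψ (Ω / 2 * x), h1, fun x => ?_,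
    fun x => ?_, fun x => ?_, fun x => ?_, fun x => ?_, fun x => ?_, ?_⟩
  · have hn : Complex.normSq (u (Ω / 2 * x)) = S (Ω / 2 * x) ^ 2 := by
      rw [huS, Complex.normSq_mul, Complex.normSq_ofReal, Complex.normSq_eq_norm_sq,
        mul_comm Complex.I, Complex.norm_exp_ofReal_mul_I]
      ring
    rw [orbit_apply_two, hn, he, mul_pow, Real.sq_sqrt hδ.le]
    field_simp
    ring
  · refine (h2 x).trans ?_
    rw [mul_left_comm, Complex.im_ofReal_mul]
    simp [orbit, orbitPoint]
    field_simp
    ring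
  · beta_reduce
    rw [mul_neg, hSσ]; ring
  · beta_reduce
    rw [mul_neg, hψe]
  · beta_reduce
    rw [hshift, hSp]; ring
  · beta_reduce
    rw [hshift, hψp]
  · have := solvesCGL_of_statRHS hp hν hB hB' hδ
    have heq : (fun x t : ℝ => ((√(ε * D) : ℝ) : ℂ) * u (Ω / 2 * x)
        * Complex.exp (-(Complex.I * (ω : ℂ) * (t : ℂ)))) = fun x t : ℝ =>
        ((√(ε * D) * S (Ω / 2 * x) : ℝ) : ℂ) * Complex.exp (Complex.I * (ψ (Ω / 2 * x) : ℂ)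
          - Complex.I * (ω : ℂ) * (t : ℂ)) := by
      ext x t
      rw [huS, sub_eq_add_neg, Complex.exp_add]
      push_cast
      ring
    rwa [heq] at this

end fixedParameter

/-! ### Matching the parameters and the lowest order. -/

/-- Multiplying out, the bracket becomes `(1 + iα) + t (1 + iβ) r`. Its real part fixes the squared
frequency `μ / den` of the profile and its imaginary part fixes `ω`. -/
theorem frequency_identity {μ α β ω t den ρ₁ ρ₂ : ℝ} {ν r : ℂ} (hden : den = 1 + t * ρ₁)
    (hden0 : den ≠ 0) (hν : (1 + Complex.I * α) * ν = 1 + Complex.I * β)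
    (hr : (1 + Complex.I * β) * r = ρ₁ + Complex.I * ρ₂) (hω : den * ω = μ * (α + t * ρ₂)) :
    (1 + Complex.I * α) * (((μ / den : ℝ) : ℂ) * (1 + t * ν * r)) = μ + Complex.I * ω := by
  have h0 : (den : ℂ) ≠ 0 := by exact_mod_cast hden0
  have h1 : (den : ℂ) = 1 + t * ρ₁ := by exact_mod_cast hden
  have h2 : (den : ℂ) * ω = μ * (α + t * ρ₂) := by exact_mod_cast hω
  push_cast
  field_simp
  linear_combination μ * t * r * hν + μ * t * hr - μ * h1 - Complex.I * h2

theorem zeroOrder_eq {μ α β lam a₂ σ c c' τ : ℝ} {u u' : ℝ → ℂ} (hμ : 0 < μ) (hαβ : α ≠ β)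
    (hu : u (√μ * τ) = c) (hu' : u' (√μ * τ) = c')
    (h1 : 2 * c ^ 2 = 1 - σ * Real.cos (2 * (√μ * τ)))
    (h2 : 2 * c' ^ 2 = 1 + σ * Real.cos (2 * (√μ * τ)))
    (h3 : 2 * (c * c') = σ * Real.sin (2 * (√μ * τ))) :
    orbit μ α β lam (μ * α) 0 (-(4 * dC α β * a₂)) (-(3 * dC α β * a₂)) (2 * √μ) u u' (√μ * τ) =
      zeroOrder μ α β lam a₂ σ τ := by
  have hd := dC_ne_zero hαβ
  have hA : (1 + α ^ 2 : ℝ) ≠ 0 := by positivity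
  have hsq : √μ ^ 2 = μ := Real.sq_sqrt hμ.le
  have he : eTilde μ α β lam (μ * α) = 4 * lam * μ := by
    rw [eTilde_eq hαβ]
    have : eC μ α β (μ * α) = 0 := by simp [eC]
    rw [this]; field_simp; ring
  have hP : (μ + α * (μ * α)) / (1 + α ^ 2) = μ := by field_simp
  have hθ : 2 * √μ * τ = 2 * (√μ * τ) := by ring
  ext i
  simp only [orbit, orbitPoint, zeroOrder, hu, hu', he, hP, hθ]
  generalize Real.cos (2 * (√μ * τ)) = C at *
  generalize Real.sin (2 * (√μ * τ)) = s at *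
  fin_cases i
  · simp
    field_simp
    linear_combination (-2 * a₂ * lam * 4) * hsq * c' ^ 2 - 4 * a₂ * lam * μ * h1
      - 4 * a₂ * lam * μ * h2
  · simp
    field_simp
    linear_combination (-2) * lam ^ 2 * a₂ * (aC α β)⁻¹ * h3
  · simp
    field_simp
    linear_combination (-2) * a₂ * h1
  · simp
    field_simp
    linear_combination (-2) * a₂ * h3

end CGL

end

/-! ### Choice of the parameters and assembly. -/

open CGL in
theorem mainTheorem1 (μ α β lam a₂ σ : ℝ) (hμ : 0 < μ) (hαβ : α ≠ β)
    (hlam : IsLambda α β lam) (ha₂ : a₂ ≠ 0) (hσ : σ = 1 ∨ σ = -1) :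
    ∃ ε₀ > (0 : ℝ), ∃ C : ℝ, ∃ ω k₁ k₂ γ Ω q : ℝ → ℝ, ∃ X : ℝ → ℝ → Fin 4 → ℝ,
      -- the parameters and the orbits depend continuously on `ε`, with given values at `ε = 0`
      ContinuousOn ω (Set.Ioo (-ε₀) ε₀) ∧ ContinuousOn k₁ (Set.Ioo (-ε₀) ε₀) ∧
      ContinuousOn k₂ (Set.Ioo (-ε₀) ε₀) ∧ ContinuousOn γ (Set.Ioo (-ε₀) ε₀) ∧
      ContinuousOn Ω (Set.Ioo (-ε₀) ε₀) ∧ ContinuousOn q (Set.Ioo (-ε₀) ε₀) ∧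
      ContinuousOn (fun p : ℝ × ℝ => X p.1 p.2) (Set.Ioo (-ε₀) ε₀ ×ˢ Set.univ) ∧
      ω 0 = μ * α ∧ k₂ 0 = -(3 * lam / aC α β * dC α β * a₂) ∧
      γ 0 = cC α β / aC α β * a₂ ∧ Ω 0 = 2 * √μ ∧ q 0 = √μ ∧
      (∀ τ, X 0 τ = zeroOrder μ α β lam a₂ σ τ) ∧
      ∀ ε ∈ Set.Ioo (-ε₀) ε₀,
        -- the double eigenvalue `0` has two independent eigenvectors, the others are imaginary
        0 < eTilde μ α β lam (ω ε) / lam ∧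
        k₁ ε = -(lam * eTilde μ α β lam (ω ε) / aC α β) ∧
        Module.finrank ℝ
          (LinearMap.ker (Matrix.toLin' (linMatrix μ α β lam (ω ε) (k₁ ε)))) = 2 ∧
        eC μ α β (ω ε) =
          eTilde μ α β lam (ω ε) + aC α β / lam * (k₁ ε + ε * k₂ ε) ∧
        0 < Ω ε ∧ Ω ε ^ 2 = eTilde μ α β lam (ω ε) / lam + ε * γ ε ∧
        -- the plane wave of frequency `ω ε` has wavenumber `± q ε`
        0 < q ε ∧ ω ε = μ * β + (α - β) * q ε ^ 2 ∧ eC μ α β (ω ε) = μ - q ε ^ 2 ∧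
        -- the rescaled system and the 4-D system itself
        (∀ τ, HasDerivAt (X ε)
          ((linMatrix μ α β lam (ω ε) (k₁ ε)).mulVec (X ε τ)
            + ε • quadPart α β lam (k₂ ε) (X ε τ)) τ) ∧
        (∀ τ, HasDerivAt (fun s => ε • X ε s)
          (field4 μ α β lam (ω ε) (k₁ ε + ε * k₂ ε) (ε • X ε τ)) τ) ∧
        (∀ τ, Consistent μ α β lam (ω ε) (ε • X ε τ)) ∧
        IsSymmetricOrbit (X ε) ∧ Function.Periodic (X ε) (2 * Real.pi / Ω ε) ∧
        (∀ τ, ‖X ε τ‖ ≤ C) ∧ (¬ ∃ P₀, ∀ τ, X ε τ 2 = P₀) ∧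
        -- the stationary solutions of the Ginzburg-Landau equation, in the range of `ε` where
        -- `e + d P` is non-negative
        (ε * dC α β * a₂ < 0 → ∃ R φ : ℝ → ℝ,
          SolvesStationary μ α β (ω ε) R φ ∧
          (∀ x, R x ^ 2 = eC μ α β (ω ε) + dC α β * (ε * X ε x 2)) ∧
          (∀ x, angMom R φ x =
            (aC α β / lam * (ε * X ε x 1) - lam * (ε * X ε x 3)) / (1 + α ^ 2)) ∧
          (∀ x, R (-x) = -σ * R x) ∧ (∀ x, φ (-x) = φ x) ∧
          (∀ x, R (x + 2 * Real.pi / Ω ε) = -R x) ∧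
          Function.Periodic φ (2 * Real.pi / Ω ε) ∧
          (∀ x, R x ^ 2 ≤ C * |ε|) ∧
          SolvesCGL μ α β (fun x t =>
            (R x : ℂ) * Complex.exp (Complex.I * (φ x : ℂ) - Complex.I * (ω ε : ℂ) * (t : ℂ)))) := by
  have hb : β - α ≠ 0 := sub_ne_zero.2 hαβ.symm
  have hA : (1 + α ^ 2 : ℝ) ≠ 0 := by positivity
  have hd := dC_ne_zero hαβ
  have ha := aC_ne_zero hαβ
  have hl := lam_ne_zero hαβ hlam
  have hα0 : (1 + Complex.I * α : ℂ) ≠ 0 := by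
    intro h
    have := congrArg Complex.re h
    simp at this
  obtain ⟨ν, hν⟩ : ∃ ν : ℂ, (1 + Complex.I * α) * ν = 1 + Complex.I * β :=
    ⟨(1 + Complex.I * β) / (1 + Complex.I * α), mul_div_cancel₀ _ hα0⟩
  obtain ⟨t₀, ht₀, u, u', r, c, c', huc, huc', hrc, hu0, hu0', hr0, hc1, hc2, hc3, hprof⟩ :=
    exists_profile ν hσ
  -- the parameters as functions of `ε`
  obtain ⟨κ, hκ⟩ : ∃ κ : ℝ, κ = -(4 * dC α β * a₂) := ⟨_, rfl⟩
  have hκ0 : κ ≠ 0 := by rw [hκ]; simp [hd, ha₂]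
  -- With `Ω² / 4 = μ / den` and `D = κ / den`, this is what `Ω² t / 4 = ε D` demands.
  obtain ⟨t, ht⟩ : ∃ t : ℝ → ℝ, ∀ ε, t ε = κ * ε / μ := ⟨fun ε => κ * ε / μ, fun _ => rfl⟩
  have htc : Continuous t := by
    rw [show t = _ from funext ht]; fun_prop
  have ht00 : t 0 = 0 := by simp [ht]
  obtain ⟨ρ₁, hρ₁⟩ : ∃ ρ₁ : ℝ → ℝ, ∀ ε, ρ₁ ε = ((1 + Complex.I * β) * r (t ε)).re :=
    ⟨fun ε => ((1 + Complex.I * β) * r (t ε)).re, fun _ => rfl⟩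
  obtain ⟨ρ₂, hρ₂⟩ : ∃ ρ₂ : ℝ → ℝ, ∀ ε, ρ₂ ε = ((1 + Complex.I * β) * r (t ε)).im :=
    ⟨fun ε => ((1 + Complex.I * β) * r (t ε)).im, fun _ => rfl⟩
  have hρ : ∀ ε, (1 + Complex.I * β) * r (t ε) = ρ₁ ε + Complex.I * ρ₂ ε := fun ε => by
    rw [hρ₁, hρ₂]
    linear_combination -Complex.re_add_im ((1 + Complex.I * β) * r (t ε))
  have hρ₁c : Continuous ρ₁ := by
    rw [show ρ₁ = _ from funext hρ₁]
    exact Complex.continuous_re.comp (continuous_const.mul (hrc.comp htc))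
  have hρ₂c : Continuous ρ₂ := by
    rw [show ρ₂ = _ from funext hρ₂]
    exact Complex.continuous_im.comp (continuous_const.mul (hrc.comp htc))
  have hr00 : (1 + Complex.I * β) * r (t 0) = ((3 / 4 : ℝ) : ℂ) + ((3 / 4 * β : ℝ) : ℂ) * Complex.I := by
    rw [ht00, hr0]; push_cast; ring
  have hρ₁0 : ρ₁ 0 = 3 / 4 := by rw [hρ₁, hr00]; simp
  have hρ₂0 : ρ₂ 0 = 3 / 4 * β := by rw [hρ₂, hr00]; simp
  -- The maximum with `1 / 2` keeps the denominator positive for all `ε`, so every parameter is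
  -- continuous on the line; it is inactive in the final range.
  obtain ⟨den, hden⟩ : ∃ den : ℝ → ℝ, ∀ ε, den ε = max (1 + t ε * ρ₁ ε) (1 / 2) :=
    ⟨fun ε => max (1 + t ε * ρ₁ ε) (1 / 2), fun _ => rfl⟩
  have hdenpos : ∀ ε, 0 < den ε := fun ε => by
    rw [hden]; exact lt_max_of_lt_right (by norm_num)
  have hdenc : Continuous den := by
    rw [show den = _ from funext hden]; fun_prop
  have hden0 : den 0 = 1 := by rw [hden, ht00]; norm_num
  obtain ⟨D, hD⟩ : ∃ D : ℝ → ℝ, ∀ ε, D ε = κ / den ε := ⟨fun ε => κ / den ε, fun _ => rfl⟩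
  have hDc : Continuous D := by
    rw [show D = _ from funext hD]
    exact continuous_const.div hdenc fun ε => (hdenpos ε).ne'
  have hD0 : ∀ ε, D ε ≠ 0 := fun ε => by
    rw [hD]; exact div_ne_zero hκ0 (hdenpos ε).ne'
  -- `ε η` is the squared plane-wave amplitude `e`, obtained by solving the imaginary part of the
  -- frequency identity for `ω - μ α`.
  obtain ⟨η, hη⟩ : ∃ η : ℝ → ℝ, ∀ ε, η ε = dC α β * κ * (ρ₂ ε - α * ρ₁ ε) / den ε :=
    ⟨fun ε => dC α β * κ * (ρ₂ ε - α * ρ₁ ε) / den ε, fun _ => rfl⟩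
  have hηc : Continuous η := by
    rw [show η = _ from funext hη]
    exact Continuous.div (by fun_prop) hdenc fun ε => (hdenpos ε).ne'
  have hη0 : η 0 = -(3 * dC α β * a₂) := by
    rw [hη, hρ₁0, hρ₂0, hden0, hκ]
    unfold dC; field_simp
  obtain ⟨ω, hω⟩ : ∃ ω : ℝ → ℝ, ∀ ε, ω ε = μ * α + ε * η ε * (β - α) :=
    ⟨fun ε => μ * α + ε * η ε * (β - α), fun _ => rfl⟩
  have hωc : Continuous ω := by
    rw [show ω = _ from funext hω]; fun_prop
  have hω0 : ω 0 = μ * α := by rw [hω]; ring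
  have he : ∀ ε, eC μ α β (ω ε) = ε * η ε := fun ε => by
    rw [eC, hω]; field_simp
    ring
  have hetc : Continuous fun ε => eTilde μ α β lam (ω ε) := by
    simp only [eTilde, bC, div_eq_mul_inv]; fun_prop
  obtain ⟨Ω, hΩ⟩ : ∃ Ω : ℝ → ℝ, ∀ ε, Ω ε = 2 * √(μ / den ε) :=
    ⟨fun ε => 2 * √(μ / den ε), fun _ => rfl⟩
  have hΩpos : ∀ ε, 0 < Ω ε := fun ε => by
    have := hdenpos ε
    rw [hΩ]; positivity
  have hΩc : Continuous Ω := by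
    rw [show Ω = _ from funext hΩ]
    exact continuous_const.mul
      (continuous_const.div hdenc fun ε => (hdenpos ε).ne').sqrt
  have hΩ0 : Ω 0 = 2 * √μ := by rw [hΩ, hden0, div_one]
  have hΩsq : ∀ ε, Ω ε ^ 2 / 4 = μ / den ε := fun ε => by
    have := hdenpos ε
    rw [hΩ, mul_pow, Real.sq_sqrt (by positivity)]; ring
  have htD : ∀ ε, Ω ε ^ 2 / 4 * t ε = ε * D ε := fun ε => by
    have := (hdenpos ε).ne'
    rw [hΩsq, ht, hD]; field_simp
  -- the orbits as functions of `ε` and of the phase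
  obtain ⟨Y, hY⟩ : ∃ Y : ℝ → ℝ → Fin 4 → ℝ, ∀ ε, Y ε =
      orbit μ α β lam (ω ε) ε (D ε) (η ε) (Ω ε) (u (t ε)) (u' (t ε)) := ⟨_, fun _ => rfl⟩
  have hYc : Continuous fun q : ℝ × ℝ => Y q.1 q.2 := by
    have h1 : Continuous fun q : ℝ × ℝ => u (t q.1) q.2 :=
      huc.comp ((htc.comp continuous_fst).prodMk continuous_snd)
    have h2 : Continuous fun q : ℝ × ℝ => u' (t q.1) q.2 :=
      huc'.comp ((htc.comp continuous_fst).prodMk continuous_snd)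
    have h3 : Continuous fun q : ℝ × ℝ => starRingEnd ℂ (u (t q.1) q.2) * u' (t q.1) q.2 :=
      (Complex.continuous_conj.comp h1).mul h2
    simp only [hY, orbit]
    exact continuous_orbitPoint μ α β lam (hωc.comp continuous_fst) continuous_fst
      (hDc.comp continuous_fst) (hηc.comp continuous_fst) (Complex.continuous_normSq.comp h1)
      (((hΩc.comp continuous_fst).div_const 2).mul (Complex.continuous_re.comp h3))
      ((((hΩc.comp continuous_fst).pow 2).div_const 4).mul (Complex.continuous_normSq.comp h2))
      (((hΩc.comp continuous_fst).div_const 2).mul (Complex.continuous_im.comp h3))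
  -- the range of `ε`
  have hev : ∀ᶠ ε in nhds (0 : ℝ), |t ε| < t₀ ∧ 1 / 2 < 1 + t ε * ρ₁ ε ∧
      0 < eTilde μ α β lam (ω ε) / lam ∧ 0 < μ - ε * η ε := by
    refine Filter.Eventually.and ?_ (Filter.Eventually.and ?_ (Filter.Eventually.and ?_ ?_))
    · refine (htc.abs.tendsto 0).eventually (gt_mem_nhds ?_)
      rw [ht00, abs_zero]; exact ht₀
    · refine ((by fun_prop : Continuous fun ε => 1 + t ε * ρ₁ ε).tendsto 0).eventually
        (lt_mem_nhds ?_)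
      rw [ht00]; norm_num
    · refine ((hetc.div_const lam).tendsto 0).eventually (lt_mem_nhds ?_)
      rw [eTilde_eq hαβ, he, hω0]
      have : (4 * lam * ((μ + α * (μ * α)) / (1 + α ^ 2)) -
          6 * lam * ((1 + α * β) / (1 + α ^ 2)) * (0 * η 0)) / lam = 4 * μ := by
        field_simp; ring
      rw [this]; positivity
    · refine ((by fun_prop : Continuous fun ε => μ - ε * η ε).tendsto 0).eventually
        (lt_mem_nhds ?_)
      simpa using hμ
  obtain ⟨ε₁, hε₁, hball⟩ := Metric.eventually_nhds_iff.1 hev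
  have hin : ∀ ε ∈ Set.Ioo (-(ε₁ / 2)) (ε₁ / 2), dist ε 0 < ε₁ := fun ε hε => by
    rw [Real.dist_0_eq_abs, abs_lt]; constructor <;> linarith [hε.1, hε.2]
  obtain ⟨C₀, hC₀⟩ := ((isCompact_Icc (a := -(ε₁ / 2)) (b := ε₁ / 2)).prod
    (isCompact_Icc (a := (0 : ℝ)) (b := Real.pi))).exists_bound_of_continuousOn hYc.continuousOn
  obtain ⟨C₁, hC₁⟩ := (isCompact_Icc (a := -(ε₁ / 2)) (b := ε₁ / 2)).exists_bound_of_continuousOn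
    hηc.continuousOn
  have hC₀0 : 0 ≤ C₀ := (norm_nonneg _).trans
    (hC₀ (0, 0) ⟨⟨by linarith, by linarith⟩, le_rfl, Real.pi_pos.le⟩)
  have hC₁0 : 0 ≤ C₁ := (norm_nonneg _).trans (hC₁ 0 ⟨by linarith, by linarith⟩)
  -- Since `k₁` cancels `ẽ`, the relation for `e` reads `ε η = (a / lam) ε k₂`, whence `k₂`. The
  -- function `γ` is `(Ω² - ẽ / lam) / ε` with the factor `ε` already divided out, so it makes sense
  -- at `ε = 0`. The constant bounds the orbit by `C₀` and `R² = ε (η + d z)` by `(C₁ + |d| C₀)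
  -- |ε|`.
  refine ⟨ε₁ / 2, by linarith, C₀ + C₁ + |dC α β| * C₀, ω,
    fun ε => -(lam * eTilde μ α β lam (ω ε) / aC α β), fun ε => lam / aC α β * η ε,
    fun ε => -(4 * κ * ρ₁ ε / den ε)
      - (4 * α * (β - α) - 6 * (1 + α * β)) * η ε / (1 + α ^ 2),
    Ω, fun ε => √(μ - ε * η ε), fun ε τ => Y ε (Ω ε / 2 * τ), hωc.continuousOn,
    ((continuous_const.mul hetc).div_const _).neg.continuousOn,
    (continuous_const.mul hηc).continuousOn, ?_, hΩc.continuousOn,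
    (by fun_prop : Continuous fun ε => √(μ - ε * η ε)).continuousOn, ?_, hω0, ?_, ?_, hΩ0, ?_,
    ?_, ?_⟩
  · refine Continuous.continuousOn (Continuous.sub (Continuous.neg ?_) (by fun_prop))
    exact Continuous.div (by fun_prop) hdenc fun ε => (hdenpos ε).ne'
  · have h : Continuous fun p : ℝ × ℝ => (p.1, Ω p.1 / 2 * p.2) := by fun_prop
    exact (hYc.comp h).continuousOn
  · simp only [hη0]; ring
  · simp only [hη0, hρ₁0, hden0, hκ, cC, aC, dC]
    field_simp; ring
  · simp
  · intro τ
    have h2 : Ω 0 / 2 * τ = √μ * τ := by rw [hΩ0]; ring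
    have hD00 : D 0 = -(4 * dC α β * a₂) := by rw [hD, hden0, hκ, div_one]
    simp only [h2]
    rw [hY, hω0, hD00, hη0, hΩ0, ht00]
    exact zeroOrder_eq hμ hαβ (hu0 _) (hu0' _) (hc1 _) (hc2 _) (hc3 _)
  · intro ε hε
    obtain ⟨hE1, hE2, hE3, hE4⟩ := hball (hin ε hε)
    have hIcc : ε ∈ Set.Icc (-(ε₁ / 2)) (ε₁ / 2) := ⟨hε.1.le, hε.2.le⟩
    have hdenε : den ε = 1 + t ε * ρ₁ ε := by rw [hden, max_eq_left hE2.le]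
    have hdne := (hdenpos ε).ne'
    obtain ⟨hd1, hd2, hpar, hanti, ⟨θ₁, θ₂, hθ₁, hθ₂⟩, S, ψ, hS, hψ, huS, hSσ, hSp, hψe, hψp⟩ :=
      hprof (t ε) hE1.le
    have hp : (1 + Complex.I * α) * (((Ω ε ^ 2 / 4 : ℝ) : ℂ) * (1 + t ε * ν * r (t ε)))
        = μ + Complex.I * ω ε := by
      rw [hΩsq]
      refine frequency_identity hdenε hdne hν (hρ ε) ?_
      rw [hω, hη]
      have h1 : ε * κ = μ * t ε := by rw [ht]; field_simp
      have h2 : dC α β * (β - α) = 1 := by unfold dC; field_simp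
      have h3 : den ε * (dC α β * κ * (ρ₂ ε - α * ρ₁ ε) / den ε) =
          dC α β * κ * (ρ₂ ε - α * ρ₁ ε) := mul_div_cancel₀ _ hdne
      linear_combination ε * (β - α) * h3 + ε * κ * (ρ₂ ε - α * ρ₁ ε) * h2
        + (ρ₂ ε - α * ρ₁ ε) * h1 + μ * α * hdenε
    have hder : ∀ τ, HasDerivAt (fun τ => Y ε (Ω ε / 2 * τ))
        ((linMatrix μ α β lam (ω ε) (-(lam * eTilde μ α β lam (ω ε) / aC α β))).mulVec
          (Y ε (Ω ε / 2 * τ)) + ε • quadPart α β lam (lam / aC α β * η ε)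
            (Y ε (Ω ε / 2 * τ))) τ := by
      intro τ
      simp only [hY, orbit_eq]
      exact hasDerivAt_orbitPoint hαβ hlam (he ε) hp hν
        (B := fun y => u (t ε) (Ω ε / 2 * y))
        (B' := fun y => ((Ω ε / 2 : ℝ) : ℂ) * u' (t ε) (Ω ε / 2 * y))
        (hasDerivAt_comp_phase (hd1 _)) (hasDerivAt_scaled_deriv hd2 rfl (htD ε) τ)
    have hYper : Function.Periodic (Y ε) Real.pi := by
      rw [hY]; exact orbit_periodic hd1 hanti
    have hYb : ∀ θ, ‖Y ε θ‖ ≤ C₀ := fun θ => by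
      obtain ⟨y, hy, hy'⟩ := hYper.exists_mem_Ico₀ Real.pi_pos θ
      rw [hy']
      exact hC₀ (ε, y) ⟨hIcc, hy.1, hy.2.le⟩
    have hY2 : ∀ θ, Y ε θ 2 = (D ε * Complex.normSq (u (t ε) θ) - η ε) / dC α β := fun θ => by
      rw [hY, orbit_apply_two]
    have hcancel : ∀ θ, Ω ε / 2 * (2 * θ / Ω ε) = θ := fun θ => by
      have := (hΩpos ε).ne'
      field_simp
    refine ⟨hE3, rfl, finrank_ker_linMatrix _ hl, ?_, hΩpos ε, ?_, Real.sqrt_pos.2 hE4, ?_, ?_,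
      hder, fun τ => ?_, fun τ => ?_, fun τ => ?_, fun τ => ?_, fun τ => ?_, ?_, fun hneg => ?_⟩
    · rw [he]; field_simp; ring
    · have h4 : Ω ε ^ 2 = 4 * (μ / den ε) := by rw [← hΩsq]; ring
      have h5 : ε * κ = μ * t ε := by rw [ht]; field_simp
      have h6 : eTilde μ α β lam (ω ε) / lam = 4 * μ
          + ε * ((4 * α * (β - α) - 6 * (1 + α * β)) * η ε / (1 + α ^ 2)) := by
        rw [eTilde_eq hαβ, he, hω]; field_simp; ring
      have h7 : μ / den ε = μ - ε * κ * ρ₁ ε / den ε := by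
        rw [h5, eq_sub_iff_add_eq, ← add_div, div_eq_iff hdne, hdenε]; ring
      rw [h4, h6, h7]; ring
    · rw [Real.sq_sqrt hE4.le, hω]; ring
    · rw [Real.sq_sqrt hE4.le, he]; ring
    · rw [field4_smul]; exact (hder τ).const_smul ε
    · beta_reduce
      rw [hY]; exact consistent_orbit hαβ hlam (he ε) _
    · simp only [mul_neg, hY]
      exact orbit_neg hσ hd1 hpar _
    · have : Ω ε / 2 * (τ + 2 * Real.pi / Ω ε) = Ω ε / 2 * τ + Real.pi := by
        rw [mul_add, hcancel]
      simp only [this, hYper _]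
    · refine (hYb _).trans ?_
      have : 0 ≤ |dC α β| * C₀ := by positivity
      linarith
    -- `P` is affine in `|u|²` with nonzero slope, and the profile has both a zero and a nonzero
    -- value.
    · rintro ⟨P₀, hP₀⟩
      have h := (hP₀ (2 * θ₁ / Ω ε)).trans (hP₀ (2 * θ₂ / Ω ε)).symm
      simp only [hcancel, hY2, hθ₁, map_zero] at h
      rw [div_left_inj' hd] at h
      have h8 : D ε * Complex.normSq (u (t ε) θ₂) = 0 := by linarith
      rcases mul_eq_zero.1 h8 with h9 | h9
      · exact hD0 ε h9
      · exact hθ₂ (Complex.normSq_eq_zero.1 h9)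
    · have hδ : 0 < ε * D ε := by
        rw [hD, ← mul_div_assoc]
        refine div_pos ?_ (hdenpos ε)
        rw [hκ]; linarith
      obtain ⟨R, φ, h1, h2, h3, h4, h5, h6, h7, h8⟩ := exists_stationary hαβ hlam (he ε)
        (hΩpos ε) hδ hp hν (htD ε) hd1 hd2 hS hψ huS hSσ hSp hψe hψp
      rw [← hY] at h2 h3
      refine ⟨R, φ, h1, h2, h3, h4, h5, h6, h7, fun x => ?_, h8⟩
      rw [h2, he]
      have h10 : |Y ε (Ω ε / 2 * x) 2| ≤ C₀ := (norm_le_pi_norm _ 2).trans (hYb _)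
      have h11 : |η ε| ≤ C₁ := hC₁ ε hIcc
      calc ε * η ε + dC α β * (ε * Y ε (Ω ε / 2 * x) 2)
          = ε * (η ε + dC α β * Y ε (Ω ε / 2 * x) 2) := by ring
        _ ≤ |ε| * |η ε + dC α β * Y ε (Ω ε / 2 * x) 2| := by
            rw [← abs_mul]; exact le_abs_self _
        _ ≤ |ε| * (C₁ + |dC α β| * C₀) := by
            gcongr
            refine (abs_add_le _ _).trans ?_
            rw [abs_mul]
            gcongr
        _ ≤ (C₀ + C₁ + |dC α β| * C₀) * |ε| := by nlinarith [abs_nonneg ε]
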